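/- **Liquid democracy.** Let $D=(V,A)$ be a directed graph on $V=\{1,\dots,n\}$ (the voters), and let $\omega:V\to\mathbb N_{>0}$ assign a weight to each voter. A delegation function on $D$ is a map $d:V\to V$ such that for each $i\in V$ either $d(i)=i$ ($i$ votes directly, and is called a guru) or $(i,d(i))\in A$, and such that the delegation digraph $H_d=(V,\{(i,d(i)) : d(i)\ne i\})$ is acyclic. The accumulated weight of $i$ is $\alpha_d(i)=\sum_{j\in T_d(i)}\omega(j)$ if $d(i)=i$, where $T_d(i)$ is the set of all voters from which $i$ is reachable in $H_d$ (including $i$ itself), and $\alpha_d(i)=0$ if $d(i)\ne i$. **Problem WMaxP.** Input: a directed graph $D=(V,A)$, weights $\omega:V\to\mathbb N_{>0}$, a delegation function $d$ on $D$, a voter $i^*\in V$, a budget $k\in\mathbb N$ and a threshold $\tau\in\mathbb N$, all numbers being written in binary. Question: is there a delegation function $d'$ on $D$ with $|\{i\in V : d(i)\ne d'(i)\}|\le k$ and $\alpha_{d'}(i^*)\ge\tau$? **Theorem.** WMaxP is in XP with respect to the parameter $\overline{\mathtt{req}}=\max\bigl(0,\sum_{i\in V}\omega(i)-\tau\bigr)$.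 That is, there are an algorithm and computable functions $f,g:\mathbb N\to\mathbb N$ such that the algorithm decides every instance $I$ of WMaxP in time at most $f(\overline{\mathtt{req}})\cdot|I|^{\,g(\overline{\mathtt{req}})}$, where $|I|$ is the size of $I$ in binary. (Time is counted on a random access machine whose arithmetic operations are addition and truncated subtraction, at unit cost.) In particular, WMaxP can be solved in polynomial time when $\overline{\mathtt{req}}$ is bounded by a constant, for example when $\overline{\mathtt{req}}=0$. -/

import Mathlib

/-! ## Liquid democracy: delegations and accumulated weights -/

namespace LiquidDemocracy

/-- The arcs of the delegation digraph `H_d`: `(i, j)` is an arc iff `i ≠ j` and `d i = j`. -/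
def DelegArc {n : ℕ} (d : Fin n → Fin n) (i j : Fin n) : Prop :=
  i ≠ j ∧ d i = j

/-- `d` is a delegation function on the social network `D = ([n], A)` whose delegation digraph is
acyclic: every voter `i` votes directly (`d i = i`) or delegates to an out-neighbour, and the
delegation digraph has no directed cycle. -/
def IsDelegation {n : ℕ} (A : Finset (Fin n × Fin n)) (d : Fin n → Fin n) : Prop :=
  (∀ i, d i ≠ i → (i, d i) ∈ A) ∧ ∀ i, ¬ Relation.TransGen (DelegArc d) i i

open Classical in
/-- The voters of the subtree `T_d(i)` of the delegation digraph: `i` itself and everyone who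
delegates to `i` directly or indirectly. -/
noncomputable def subtree {n : ℕ} (d : Fin n → Fin n) (i : Fin n) : Finset (Fin n) :=
  Finset.univ.filter fun j => Relation.ReflTransGen (DelegArc d) j i

/-- The accumulated weight `α_d(i)`: the weight of the subtree of `i` if `i` is a guru, and `0` if
`i` is a follower. -/
noncomputable def accWeight {n : ℕ} (ω : Fin n → ℕ+) (d : Fin n → Fin n) (i : Fin n) : ℕ :=
  if d i = i then ∑ j ∈ subtree d i, (ω j : ℕ) else 0

/-- An instance of the weight maximization problem: a partial liquid democracy election
`⟨D = ([n], A), ω, d⟩`, a voter `iStar`, a budget `k` and a threshold `τ`. -/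
structure WMaxPInstance where
  n : ℕ
  A : Finset (Fin n × Fin n)
  ω : Fin n → ℕ+
  d : Fin n → Fin n
  isDelegation : IsDelegation A d
  iStar : Fin n
  k : ℕ
  τ : ℕ

namespace WMaxPInstance

/-- The question of the weight maximization problem: can at most `k` voters change their
delegation so that `iStar` reaches accumulated weight at least `τ`? -/
def IsYes (I : WMaxPInstance) : Prop :=
  ∃ d' : Fin I.n → Fin I.n, IsDelegation I.A d' ∧
    (Finset.univ.filter fun i => I.d i ≠ d' i).card ≤ I.k ∧
    I.τ ≤ accWeight I.ω d' I.iStar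

/-- The parameter: total voting weight minus `τ`. The subtraction truncates at `0`, so instances
with `τ` above the total weight (which are no-instances) are not excluded: they have value `0`. -/
def reqBar (I : WMaxPInstance) : ℕ :=
  (∑ i, (I.ω i : ℕ)) - I.τ

/-- The input as a sequence of numbers: `n, iStar, k, τ`, the weights, the delegations, and the
adjacency matrix of the social network row by row. -/
def encode (I : WMaxPInstance) : List ℕ :=
  [I.n, (I.iStar : ℕ), I.k, I.τ]
    ++ (List.finRange I.n).map (fun i => (I.ω i : ℕ))
    ++ (List.finRange I.n).map (fun i => (I.d i : ℕ))
    ++ (List.finRange I.n).flatMap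
        (fun i => (List.finRange I.n).map fun j => if (i, j) ∈ I.A then 1 else 0)

end WMaxPInstance

end LiquidDemocracy

/-! ## Random access machines with a step count

Programs of a random access machine, in structured form. The only arithmetic operations are
addition and (truncated) subtraction, and each elementary operation costs one unit of time. As
there is no multiplication, the bit length of the numbers grows by at most one per operation, so
that this time measure is polynomially related to that of Turing machines. -/

namespace RAM

/-- A memory state: number registers and arrays of numbers. A program mentions only finitely many
registers and arrays. -/
structure State where
  reg : ℕ → ℕ
  arr : ℕ → ℕ → ℕ

/-- Expressions: constants, registers, array cells, sums and truncated differences. -/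
inductive Expr where
  | const (c : ℕ)
  | reg (r : ℕ)
  | arr (a : ℕ) (idx : Expr)
  | add (e₁ e₂ : Expr)
  | sub (e₁ e₂ : Expr)

/-- The value of an expression. -/
def Expr.val (s : State) : Expr → ℕ
  | .const c => c
  | .reg r => s.reg r
  | .arr a e => s.arr a (e.val s)
  | .add e₁ e₂ => e₁.val s + e₂.val s
  | .sub e₁ e₂ => e₁.val s - e₂.val s

/-- The time to evaluate an expression: one unit for each of its nodes. -/
def Expr.cost : Expr → ℕ
  | .const _ => 1
  | .reg _ => 1
  | .arr _ e => e.cost + 1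
  | .add e₁ e₂ => e₁.cost + e₂.cost + 1
  | .sub e₁ e₂ => e₁.cost + e₂.cost + 1

/-- Programs: doing nothing, assignment to a register, assignment to an array cell, sequential
composition, case distinction and loop (conditions hold when the value is nonzero). -/
inductive Prog where
  | skip
  | assign (r : ℕ) (e : Expr)
  | store (a : ℕ) (idx e : Expr)
  | seq (p q : Prog)
  | ite (e : Expr) (p q : Prog)
  | loop (e : Expr) (p : Prog)

/-- `Exec p s t s'`: started in state `s`, the program `p` halts after exactly `t` units of time,
in state `s'`. -/
inductive Exec : Prog → State → ℕ → State → Prop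
  | skip (s : State) : Exec .skip s 1 s
  | assign (r : ℕ) (e : Expr) (s : State) :
      Exec (.assign r e) s (e.cost + 1) { s with reg := Function.update s.reg r (e.val s) }
  | store (a : ℕ) (idx e : Expr) (s : State) :
      Exec (.store a idx e) s (idx.cost + e.cost + 1)
        { s with arr := Function.update s.arr a
                          (Function.update (s.arr a) (idx.val s) (e.val s)) }
  | seq {p q : Prog} {s s' s'' : State} {t t' : ℕ} :
      Exec p s t s' → Exec q s' t' s'' → Exec (.seq p q) s (t + t') s''
  | iteTrue {e : Expr} {p q : Prog} {s s' : State} {t : ℕ} :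
      e.val s ≠ 0 → Exec p s t s' → Exec (.ite e p q) s (e.cost + 1 + t) s'
  | iteFalse {e : Expr} {p q : Prog} {s s' : State} {t : ℕ} :
      e.val s = 0 → Exec q s t s' → Exec (.ite e p q) s (e.cost + 1 + t) s'
  | loopTrue {e : Expr} {p : Prog} {s s' s'' : State} {t t' : ℕ} :
      e.val s ≠ 0 → Exec p s t s' → Exec (.loop e p) s' t' s'' →
        Exec (.loop e p) s (e.cost + 1 + t + t') s''
  | loopFalse {e : Expr} {p : Prog} {s : State} :
      e.val s = 0 → Exec (.loop e p) s (e.cost + 1) s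

/-- Programs are deterministic: the running time and the final state are unique. -/
theorem Exec.deterministic {p : Prog} {s s₁ s₂ : State} {t₁ t₂ : ℕ}
    (h₁ : Exec p s t₁ s₁) (h₂ : Exec p s t₂ s₂) : t₁ = t₂ ∧ s₁ = s₂ := by
  induction h₁ generalizing t₂ s₂ with
  | skip | assign | store => cases h₂; exact ⟨rfl, rfl⟩
  | seq _ _ ih ih' =>
    cases h₂ with
    | seq a b =>
      obtain ⟨rfl, rfl⟩ := ih a
      obtain ⟨rfl, rfl⟩ := ih' b
      exact ⟨rfl, rfl⟩
  | iteTrue h _ ih =>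
    cases h₂ with
    | iteTrue _ a => obtain ⟨rfl, rfl⟩ := ih a; exact ⟨rfl, rfl⟩
    | iteFalse h' _ => exact absurd h' h
  | iteFalse h _ ih =>
    cases h₂ with
    | iteTrue h' _ => exact absurd h h'
    | iteFalse _ a => obtain ⟨rfl, rfl⟩ := ih a; exact ⟨rfl, rfl⟩
  | loopTrue h _ _ ih ih' =>
    cases h₂ with
    | loopTrue _ a b =>
      obtain ⟨rfl, rfl⟩ := ih a
      obtain ⟨rfl, rfl⟩ := ih' b
      exact ⟨rfl, rfl⟩
    | loopFalse h' => exact absurd h' h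
  | loopFalse h =>
    cases h₂ with
    | loopTrue h' _ _ => exact absurd h h'
    | loopFalse _ => exact ⟨rfl, rfl⟩

/-- The initial state on input `x`: the number of input words in register `0`, the input words in
array `0`, and zeros elsewhere. -/
def initState (x : List ℕ) : State where
  reg r := if r = 0 then x.length else 0
  arr a i := if a = 0 then x.getD i 0 else 0

/-- The size of an input: the total length of its words in binary, one delimiter per word. -/
def inputSize (x : List ℕ) : ℕ :=
  (x.map fun w => Nat.size w + 1).sum

end RAM

/-! ## The parameterized complexity class XP -/

/-- The parameterized decision problem with instances `α` (given to the machine through `enc`),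
yes-instances `yes` and parameter `κ` is in XP: there are one program and two computable functions
`f`, `g` such that the program halts on every instance `x`, within time `f (κ x) * |x| ^ g (κ x)`,
and accepts (final value `1` in register `0`) exactly the yes-instances. -/
def InXP {α : Type} (enc : α → List ℕ) (yes : α → Prop) (κ : α → ℕ) : Prop :=
  ∃ (p : RAM.Prog) (f g : ℕ → ℕ), Computable f ∧ Computable g ∧
    ∀ x : α, ∃ (t : ℕ) (s : RAM.State),
      RAM.Exec p (RAM.initState (enc x)) t s ∧
      t ≤ f (κ x) * RAM.inputSize (enc x) ^ g (κ x) ∧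
      (s.reg 0 = 1 ↔ yes x)

/-!
Let `r = reqBar` and `ρ = iStar`. Every voter has weight at least one, so if `ρ` reaches the
threshold, at most `r` voters stay outside the subtree of `ρ`. There are at most `n ^ r` candidates
for the set `S` of these voters, and they are enumerated by the numbers `m < n ^ r` through their
base-`n` digits (`exists_digitSet_eq`); the digit `ρ` stands for no voter.

For a fixed `S`, the voters in `S` have to change their delegation exactly if it leads out of `S`,
and the others have to form an arborescence directed towards `ρ` in the network without `S`. Keeping
a delegation is free and changing it costs one, so what remains is a shortest arborescence problem
with costs zero and one, in which the free arcs are those of a function. It is solved by the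
primal-dual method of Edmonds and Fulkerson: as long as some vertex does not reach `ρ` along free
arcs, there is a sink component not containing `ρ`; pay one unit and make all allowed arcs leaving
it free. Each component paid for is left by an arc of every arborescence, and these arcs are
different, so the number of rounds is a lower bound for the cost (`Grow.le_cost`). Conversely, an
arborescence with one non-free arc for each round, at most, is built by merging trees along the
arcs that become free (`HasLabelledTree.extend`, `Grow.exists_isTree`). The cost is smaller than
the number of vertices, so `n` rounds suffice. Only the reachability relation of the free arcs is
needed, and the program keeps it as a matrix.

Threshold zero is a separate case, because then `ρ` need not vote directly.

For the verification of the program, `wp` gives weakest preconditions under the condition that no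
loop performs more than `M` iterations in one execution. The running time of a fixed program is then
at most a polynomial in `M` (`exists_timeBound_le`), and `M = n + r + n ^ r` is at most the input
size to the power `r + 1`.
-/

/-! ### Weakest preconditions with a uniform bound on loop iterations -/

namespace RAM

namespace State

/-- The state `s` after writing `v` to register `r`. -/
def setR (s : State) (r v : ℕ) : State := { s with reg := Function.update s.reg r v }

/-- The state `s` after writing `v` to cell `i` of array `a`. -/
def setA (s : State) (a i v : ℕ) : State :=
  { s with arr := Function.update s.arr a (Function.update (s.arr a) i v) }

@[simp] theorem setR_reg (s : State) (r v r' : ℕ) :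
    (s.setR r v).reg r' = if r' = r then v else s.reg r' := by
  simp [setR, Function.update_apply]

@[simp] theorem setR_arr (s : State) (r v : ℕ) : (s.setR r v).arr = s.arr := rfl

@[simp] theorem setA_reg (s : State) (a i v : ℕ) : (s.setA a i v).reg = s.reg := rfl

@[simp] theorem setA_arr (s : State) (a i v a' i' : ℕ) :
    (s.setA a i v).arr a' i' = if a' = a ∧ i' = i then v else s.arr a' i' := by
  by_cases h : a' = a
  · subst h; simp [setA, Function.update_apply]
  · simp [setA, h]

end State

namespace Prog

/-- A time bound for `p` in runs in which each execution of a loop performs at most `M`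
iterations. -/
def timeBound (M : ℕ) : Prog → ℕ
  | skip => 1
  | assign _ e => e.cost + 1
  | store _ idx e => idx.cost + e.cost + 1
  | seq p q => p.timeBound M + q.timeBound M
  | ite e p q => e.cost + 1 + (p.timeBound M + q.timeBound M)
  | loop e p => (e.cost + 1 + p.timeBound M) * M + (e.cost + 1)

/-- The registers a program may write to. -/
def regs : Prog → List ℕ
  | skip => []
  | assign r _ => [r]
  | store _ _ _ => []
  | seq p q => p.regs ++ q.regs
  | ite _ p q => p.regs ++ q.regs
  | loop _ p => p.regs

/-- The arrays a program may write to. -/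
def arrs : Prog → List ℕ
  | skip => []
  | assign _ _ => []
  | store a _ _ => [a]
  | seq p q => p.arrs ++ q.arrs
  | ite _ p q => p.arrs ++ q.arrs
  | loop _ p => p.arrs

/-- For a fixed program, the time is polynomial in the bound on the number of iterations. -/
theorem exists_timeBound_le (p : Prog) : ∃ c e : ℕ, ∀ M, p.timeBound M ≤ c * (M + 1) ^ e := by
  have key : ∀ {c₁ e₁ c₂ e₂ M : ℕ}, c₁ * (M + 1) ^ e₁ + c₂ * (M + 1) ^ e₂ ≤
      (c₁ + c₂) * (M + 1) ^ (e₁ + e₂) := by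
    intro c₁ e₁ c₂ e₂ M
    rw [add_mul]
    gcongr <;> omega
  induction p with
  | skip => exact ⟨1, 0, fun M => by simp [timeBound]⟩
  | assign r e => exact ⟨e.cost + 1, 0, fun M => by simp [timeBound]⟩
  | store a i e => exact ⟨i.cost + e.cost + 1, 0, fun M => by simp [timeBound]⟩
  | seq p q hp hq =>
    obtain ⟨c₁, e₁, h₁⟩ := hp
    obtain ⟨c₂, e₂, h₂⟩ := hq
    exact ⟨c₁ + c₂, e₁ + e₂, fun M => (add_le_add (h₁ M) (h₂ M)).trans key⟩
  | ite e p q hp hq =>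
    obtain ⟨c₁, e₁, h₁⟩ := hp
    obtain ⟨c₂, e₂, h₂⟩ := hq
    refine ⟨e.cost + 1 + (c₁ + c₂), 0 + (e₁ + e₂), fun M => ?_⟩
    refine le_trans (add_le_add ?_ ((add_le_add (h₁ M) (h₂ M)).trans key)) key
    simp
  | loop e p hp =>
    obtain ⟨c, e', h⟩ := hp
    refine ⟨e.cost + 1 + c + (e.cost + 1), 0 + e' + 1 + 0, fun M => ?_⟩
    refine le_trans (add_le_add (?_ : _ ≤ (e.cost + 1 + c) * (M + 1) ^ (0 + e' + 1))
      (?_ : _ ≤ (e.cost + 1) * (M + 1) ^ 0)) key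
    · rw [pow_succ, ← mul_assoc]
      refine Nat.mul_le_mul (le_trans (add_le_add ?_ (h M)) key) (Nat.le_succ M)
      simp
    · simp

end Prog

/-- `wp M p s Q`: started in state `s`, the program `p` halts in a state satisfying `Q`, and each
execution of a loop on the way performs at most `M` iterations. -/
def wp (M : ℕ) : Prog → State → (State → Prop) → Prop
  | .skip, s, Q => Q s
  | .assign r e, s, Q => Q (s.setR r (e.val s))
  | .store a i e, s, Q => Q (s.setA a (i.val s) (e.val s))
  | .seq p q, s, Q => wp M p s fun s' => wp M q s' Q
  | .ite e p q, s, Q => (e.val s ≠ 0 → wp M p s Q) ∧ (e.val s = 0 → wp M q s Q)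
  | .loop e p, s, Q => ∃ k ≤ M, Nat.rec (motive := fun _ => State → Prop)
      (fun s => e.val s = 0 ∧ Q s)
      (fun _ R s => e.val s ≠ 0 ∧ wp M p s R) k s

/-- Soundness of `wp` with respect to the timed semantics. -/
theorem wp.exec {M : ℕ} {p : Prog} {s : State} {Q : State → Prop} (h : wp M p s Q) :
    ∃ t s', Exec p s t s' ∧ t ≤ p.timeBound M ∧ Q s' := by
  induction p generalizing s Q with
  | skip => exact ⟨_, _, .skip s, le_rfl, h⟩
  | assign r e => exact ⟨_, _, .assign r e s, le_rfl, h⟩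
  | store a i e => exact ⟨_, _, .store a i e s, le_rfl, h⟩
  | seq p q hp hq =>
    obtain ⟨t, s', h₁, ht, h⟩ := hp h
    obtain ⟨t', s'', h₂, ht', h⟩ := hq h
    exact ⟨_, _, h₁.seq h₂, add_le_add ht ht', h⟩
  | ite e p q hp hq =>
    by_cases he : e.val s = 0
    · obtain ⟨t, s', h₁, ht, h⟩ := hq (h.2 he)
      exact ⟨_, _, .iteFalse he h₁, by simp only [Prog.timeBound]; omega, h⟩
    · obtain ⟨t, s', h₁, ht, h⟩ := hp (h.1 he)
      exact ⟨_, _, .iteTrue he h₁, by simp only [Prog.timeBound]; omega, h⟩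
  | loop e p hp =>
    obtain ⟨k, hk, h⟩ := h
    suffices H : ∃ t s', Exec (.loop e p) s t s' ∧
        t ≤ (e.cost + 1 + p.timeBound M) * k + (e.cost + 1) ∧ Q s' by
      obtain ⟨t, s', h₁, ht, h⟩ := H
      exact ⟨t, s', h₁, ht.trans (by simp only [Prog.timeBound]; gcongr), h⟩
    clear hk
    induction k generalizing s with
    | zero => exact ⟨_, _, .loopFalse h.1, by simp, h.2⟩
    | succ k ih =>
      obtain ⟨t, s', h₁, ht, h'⟩ := hp h.2
      obtain ⟨t', s'', h₂, ht', h''⟩ := ih h'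
      refine ⟨_, _, .loopTrue h.1 h₁ h₂, ?_, h''⟩
      rw [Nat.mul_succ]
      omega

/-- `s'` differs from `s` only in registers and arrays that `p` may write to. -/
structure Frame (p : Prog) (s s' : State) : Prop where
  reg : ∀ r, r ∉ p.regs → s'.reg r = s.reg r
  arr : ∀ a, a ∉ p.arrs → s'.arr a = s.arr a

theorem Frame.refl (p : Prog) (s : State) : Frame p s s := ⟨fun _ _ => rfl, fun _ _ => rfl⟩

theorem Frame.trans {p : Prog} {s s' s'' : State} (h : Frame p s s') (h' : Frame p s' s'') :
    Frame p s s'' :=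
  ⟨fun r hr => (h'.reg r hr).trans (h.reg r hr), fun a ha => (h'.arr a ha).trans (h.arr a ha)⟩

theorem Frame.mono {p q : Prog} {s s' : State} (h : Frame p s s') (hr : p.regs ⊆ q.regs)
    (ha : p.arrs ⊆ q.arrs) : Frame q s s' :=
  ⟨fun r h' => h.reg r fun h'' => h' (hr h''), fun a h' => h.arr a fun h'' => h' (ha h'')⟩

theorem wp.mono {M : ℕ} {p : Prog} {s : State} {Q Q' : State → Prop} (h : wp M p s Q)
    (hQ : ∀ s', Q s' → Q' s') : wp M p s Q' := by
  induction p generalizing s Q Q' with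
  | skip | assign | store => exact hQ _ h
  | seq p q hp hq => exact hp h fun s' h' => hq h' hQ
  | ite e p q hp hq => exact ⟨fun he => hp (h.1 he) hQ, fun he => hq (h.2 he) hQ⟩
  | loop e p hp =>
    obtain ⟨k, hk, h⟩ := h
    refine ⟨k, hk, ?_⟩
    clear hk
    induction k generalizing s with
    | zero => exact ⟨h.1, hQ _ h.2⟩
    | succ k ih => exact ⟨h.1, hp h.2 fun s' h' => ih h'⟩

/-- Registers and arrays that are not written to keep their contents. -/
theorem wp.frame {M : ℕ} {p : Prog} {s : State} {Q : State → Prop} (h : wp M p s Q) :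
    wp M p s fun s' => Frame p s s' ∧ Q s' := by
  induction p generalizing s Q with
  | skip => exact ⟨.refl _ _, h⟩
  | assign r e =>
    exact ⟨⟨fun r' h' => by simp_all [Prog.regs], fun _ _ => rfl⟩, h⟩
  | store a i e =>
    refine ⟨⟨fun _ _ => rfl, fun a' h' => ?_⟩, h⟩
    funext i'
    simp_all [Prog.arrs]
  | seq p q hp hq =>
    refine (hp h).mono fun s' h' => (hq h'.2).mono fun s'' h'' => ⟨?_, h''.2⟩
    exact (h'.1.mono (by simp [Prog.regs]) (by simp [Prog.arrs])).trans
      (h''.1.mono (by simp [Prog.regs]) (by simp [Prog.arrs]))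
  | ite e p q hp hq =>
    exact ⟨fun he => (hp (h.1 he)).mono fun s' h' =>
        ⟨h'.1.mono (by simp [Prog.regs]) (by simp [Prog.arrs]), h'.2⟩,
      fun he => (hq (h.2 he)).mono fun s' h' =>
        ⟨h'.1.mono (by simp [Prog.regs]) (by simp [Prog.arrs]), h'.2⟩⟩
  | loop e p hp =>
    obtain ⟨k, hk, h⟩ := h
    refine ⟨k, hk, ?_⟩
    clear hk
    have H : ∀ s₀, Frame (.loop e p) s₀ s → Nat.rec (motive := fun _ => State → Prop)
        (fun s => e.val s = 0 ∧ Frame (.loop e p) s₀ s ∧ Q s)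
        (fun _ R s => e.val s ≠ 0 ∧ wp M p s R) k s := by
      intro s₀ hs₀
      induction k generalizing s with
      | zero => exact ⟨h.1, hs₀, h.2⟩
      | succ k ih =>
        refine ⟨h.1, (hp h.2).mono fun s' h' => ih h'.2 (hs₀.trans ?_)⟩
        exact h'.1.mono (by simp [Prog.regs]) (by simp [Prog.arrs])
    exact H s (.refl _ _)

/-- `for i < b do p`: the register `i` runs through the numbers below the content of register
`b`. -/
def Prog.forLt (i b : ℕ) (p : Prog) : Prog :=
  .seq (.assign i (.const 0))
    (.loop (.sub (.reg b) (.reg i)) (.seq p (.assign i (.add (.reg i) (.const 1)))))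

/-- The invariant rule for `for` loops whose body writes neither to the counter nor to the
bound. -/
theorem wp_forLt {M N i b : ℕ} {p : Prog} {s : State} {Q : State → Prop} (J : ℕ → State → Prop)
    (hN : s.reg b = N) (hNM : N ≤ M) (hbi : b ≠ i) (hb : b ∉ p.regs) (hi : i ∉ p.regs)
    (zero : J 0 (s.setR i 0))
    (step : ∀ j s', j < N → s'.reg i = j → Frame (.forLt i b p) s s' → J j s' →
      wp M p s' fun s'' => J (j + 1) (s''.setR i (j + 1)))
    (post : ∀ s', Frame (.forLt i b p) s s' → J N s' → Q s') :
    wp M (.forLt i b p) s Q := by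
  have hF : Frame (.forLt i b p) s (s.setR i 0) :=
    ⟨fun r hr => by simp_all [Prog.forLt, Prog.regs], fun _ _ => rfl⟩
  suffices H : ∀ k j s', j + k = N → s'.reg i = j → Frame (.forLt i b p) s s' → J j s' →
      Nat.rec (motive := fun _ => State → Prop)
      (fun s => (Expr.sub (.reg b) (.reg i)).val s = 0 ∧ Q s)
      (fun _ R s => (Expr.sub (.reg b) (.reg i)).val s ≠ 0 ∧
        wp M (.seq p (.assign i (.add (.reg i) (.const 1)))) s R) k s' from
    ⟨N, hNM, H N 0 _ (by simp) (by simp [Expr.val]) hF zero⟩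
  intro k
  induction k with
  | zero =>
    intro j s' hj hij hs' hJ
    obtain rfl : j = N := by omega
    refine ⟨?_, post s' hs' hJ⟩
    rw [Expr.val, Expr.val, Expr.val, hs'.reg b (by simp_all [Prog.forLt, Prog.regs]), hN, hij,
      Nat.sub_self]
  | succ k ih =>
    intro j s' hj hij hs' hJ
    refine ⟨?_, (step j s' (by omega) hij hs' hJ).frame.mono fun s'' h => ?_⟩
    · rw [Expr.val, Expr.val, Expr.val, hs'.reg b (by simp_all [Prog.forLt, Prog.regs]), hN, hij]
      omega
    · have hi' : s''.reg i = j := (h.1.reg i hi).trans hij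
      simp only [wp, Expr.val, hi']
      refine ih _ _ (by omega) (by simp) (hs'.trans ?_) h.2
      refine ⟨fun r hr => ?_, fun a ha => ?_⟩
      · rw [← h.1.reg r (by simp_all [Prog.forLt, Prog.regs])]
        simp_all [Prog.forLt, Prog.regs]
      · rw [← h.1.arr a (by simp_all [Prog.forLt, Prog.arrs])]
        rfl

end RAM

/-! ### Cheapest arborescences when one arc out of every vertex is free -/

namespace Arborescence

variable {V : Type*}

/-- Every vertex `v` other than the root `ρ` has an arc to `e v`, which is its free arc (to `f v`)
or an arc of the digraph `B`, and the natural number `rk` decreases along these arcs: thus the arcs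
form an arborescence directed towards `ρ`. -/
def IsTree (f : V → V) (B : V → V → Prop) (ρ : V) (e : V → V) (rk : V → ℕ) : Prop :=
  ∀ v, v ≠ ρ → (e v = f v ∨ B v (e v)) ∧ rk (e v) < rk v

/-- The vertex `x` lies in a sink component that does not contain `ρ`: it does not reach `ρ`, and all
vertices that it reaches reach `x`, according to the reachability relation `C`. -/
def IsSink (C : V → V → Prop) (ρ x : V) : Prop :=
  ¬ C x ρ ∧ ∀ j, C x j → C j x

/-- The reachability relation after all arcs of `B` leaving the component of `x` are made free. -/
def extend (B C : V → V → Prop) (x i j : V) : Prop :=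
  C i j ∨ C i x ∧ ∃ u w, C x u ∧ B u w ∧ C w j

/-- The reachability relations obtained from that of the free arcs by `c` rounds, each of which
pays one unit for a sink component and makes all arcs leaving it free. -/
inductive Grow (f : V → V) (B : V → V → Prop) (ρ : V) : ℕ → (V → V → Prop) → Prop
  | base : Grow f B ρ 0 fun i j => ∃ m, f^[m] i = j
  | extend {c : ℕ} {C : V → V → Prop} {x : V} : Grow f B ρ c C → IsSink C ρ x →
      Grow f B ρ (c + 1) (extend B C x)

variable {f : V → V} {B : V → V → Prop} {ρ : V} {c : ℕ} {C : V → V → Prop}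

theorem Grow.refl (h : Grow f B ρ c C) (i : V) : C i i := by
  induction h with
  | base => exact ⟨0, rfl⟩
  | extend _ _ ih => exact .inl ih

theorem Grow.free (h : Grow f B ρ c C) (i : V) : C i (f i) := by
  induction h with
  | base => exact ⟨1, rfl⟩
  | extend _ _ ih => exact .inl ih

theorem Grow.trans (h : Grow f B ρ c C) {i j k : V} (hij : C i j) (hjk : C j k) : C i k := by
  induction h generalizing i j k with
  | base =>
    obtain ⟨a, rfl⟩ := hij
    obtain ⟨b, rfl⟩ := hjk
    exact ⟨b + a, Function.iterate_add_apply f b a i⟩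
  | @extend c C x _ hx ih =>
    rcases hij with hij | ⟨hix, u, w, hu, hw, hwj⟩
    · rcases hjk with hjk | ⟨hjx, h'⟩
      · exact .inl (ih hij hjk)
      · exact .inr ⟨ih hij hjx, h'⟩
    · rcases hjk with hjk | ⟨-, h'⟩
      · exact .inr ⟨hix, u, w, hu, hw, ih hwj hjk⟩
      · exact .inr ⟨hix, h'⟩

theorem exists_isSink [Finite V] (h : Grow f B ρ c C) {v : V} (hv : ¬ C v ρ) :
    ∃ x, IsSink C ρ x := by
  classical
  have := Fintype.ofFinite V
  obtain ⟨x, hx, hmin⟩ := Finset.exists_min_image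
    (Finset.univ.filter fun x => ¬ C x ρ) (fun x => (Finset.univ.filter fun j => C x j).card)
    ⟨v, by simpa using hv⟩
  simp only [Finset.mem_filter, Finset.mem_univ, true_and] at hx hmin
  refine ⟨x, hx, fun j hj => ?_⟩
  have hsub : (Finset.univ.filter fun k => C j k) ⊆ Finset.univ.filter fun k => C x k := by
    intro k hk
    simp only [Finset.mem_filter, Finset.mem_univ, true_and] at hk ⊢
    exact h.trans hj hk
  have := Finset.eq_of_subset_of_card_le hsub (hmin j fun hjρ => hx (h.trans hj hjρ))
  have hmem : x ∈ Finset.univ.filter fun k => C x k := by simpa using h.refl x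
  rw [← this] at hmem
  simpa using hmem

/-- The number of vertices other than the root whose arc is not the free one. -/
def cost [Fintype V] [DecidableEq V] (f : V → V) (ρ : V) (e : V → V) : ℕ :=
  (Finset.univ.filter fun v => v ≠ ρ ∧ e v ≠ f v).card

/-- Weak duality. Each component that was paid for is left by an arc of the tree, which is not free
before and free afterwards, so different rounds give different vertices. -/
theorem Grow.le_cost [Fintype V] [DecidableEq V] (h : Grow f B ρ c C) {e : V → V} {rk : V → ℕ} (he : IsTree f B ρ e rk) :
    c ≤ cost f ρ e := by
  classical
  suffices H : c ≤ (Finset.univ.filter fun v => v ≠ ρ ∧ e v ≠ f v ∧ C v (e v)).card by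
    refine H.trans (Finset.card_le_card fun v => ?_)
    simp only [Finset.mem_filter, Finset.mem_univ, true_and]
    exact fun hv => ⟨hv.1, hv.2.1⟩
  induction h with
  | base => exact Nat.zero_le _
  | @extend c C x h hx ih =>
    obtain ⟨v, hv, hmin⟩ := Finset.exists_min_image (Finset.univ.filter fun v => C x v) rk
      ⟨x, by simpa using h.refl x⟩
    simp only [Finset.mem_filter, Finset.mem_univ, true_and] at hv hmin
    have hvρ : v ≠ ρ := by rintro rfl; exact hx.1 hv
    have hout : ¬ C v (e v) := fun hC =>
      absurd (he v hvρ).2 (not_lt.2 (hmin _ (h.trans hv hC)))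
    have hvf : e v ≠ f v := fun h' => hout (h' ▸ h.free v)
    refine Nat.succ_le_of_lt (lt_of_le_of_lt ih (Finset.card_lt_card ?_))
    rw [Finset.ssubset_iff_of_subset fun w => ?_]
    · refine ⟨v, ?_, ?_⟩
      · simp only [Finset.mem_filter, Finset.mem_univ, true_and]
        exact ⟨hvρ, hvf, .inr ⟨hx.2 v hv, v, e v, hv, (he v hvρ).1.resolve_left hvf, h.refl _⟩⟩
      · simp [hout]
    · simp only [Finset.mem_filter, Finset.mem_univ, true_and]
      exact fun hw => ⟨hw.1, hw.2.1, .inl hw.2.2⟩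

/-- The vertices that reach `x` have a tree directed towards `x` in which the vertices with a
non-free arc get distinct labels: the label `s` of `v` is a round `s < c` such that `v` belongs to
the component `K s` paid for in that round. -/
def HasLabelledTree (f : V → V) (B : V → V → Prop) (c : ℕ) (C : V → V → Prop) (K : ℕ → Set V)
    (x : V) : Prop :=
  ∃ (e : V → V) (rk ℓ : V → ℕ),
    (∀ v, C v x → v ≠ x → C (e v) x ∧ rk (e v) < rk v ∧
      (e v = f v ∨ B v (e v) ∧ ℓ v < c ∧ v ∈ K (ℓ v))) ∧
    ∀ v₁ v₂, C v₁ x → v₁ ≠ x → e v₁ ≠ f v₁ → C v₂ x → v₂ ≠ x → e v₂ ≠ f v₂ → ℓ v₁ = ℓ v₂ → v₁ = v₂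

theorem hasLabelledTree_base (K : ℕ → Set V) (x : V) :
    HasLabelledTree f B 0 (fun i j => ∃ m, f^[m] i = j) K x := by
  classical
  refine ⟨f, fun v => if h : ∃ m, f^[m] v = x then Nat.find h else 0, fun _ => 0,
    fun v hv hvx => ?_, fun v₁ v₂ _ _ h => absurd rfl h⟩
  have hpos : Nat.find hv ≠ 0 := fun h0 => hvx (by simpa [h0] using Nat.find_spec hv)
  obtain ⟨m, hm⟩ := Nat.exists_eq_succ_of_ne_zero hpos
  have hmx : f^[m] (f v) = x := by
    rw [← Function.iterate_succ_apply, ← hm]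
    exact Nat.find_spec hv
  have hfv : ∃ m, f^[m] (f v) = x := ⟨m, hmx⟩
  refine ⟨hfv, ?_, .inl rfl⟩
  simp only [hv, hfv, dite_true, hm]
  exact Nat.lt_succ_of_le (Nat.find_le hmx)

/-- Two trees are merged along an arc from the component of `x` to a vertex that reaches `y`. The
vertices that reach `y` keep their tree; the others are hung below. The labels remain distinct
because a component paid for earlier lies either among the vertices that reach `y` or among the
others. -/
theorem HasLabelledTree.extend [Fintype V] (h : Grow f B ρ c C) {x : V} (hx : IsSink C ρ x)
    {K : ℕ → Set V}
    (hK : ∀ s < c, ∀ u ∈ K s, ∀ v ∈ K s, C u v) (hKc : K c = {j | C x j})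
    (ht : ∀ y, HasLabelledTree f B c C K y) (y : V) :
    HasLabelledTree f B (c + 1) (Arborescence.extend B C x) K y := by
  classical
  by_cases hy : ¬ C x y ∧ ∃ u w, C x u ∧ B u w ∧ C w y
  · obtain ⟨hxy, u, w, hxu, huw, hwy⟩ := hy
    have huy : ¬ C u y := fun h' => hxy (h.trans hxu h')
    obtain ⟨e₁, rk₁, ℓ₁, h₁, inj₁⟩ := ht y
    obtain ⟨e₂, rk₂, ℓ₂, h₂, inj₂⟩ := ht u
    have hiff : ∀ v, Arborescence.extend B C x v y ↔ C v y ∨ C v u := by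
      intro v
      refine ⟨?_, ?_⟩
      · rintro (h' | ⟨h', -⟩)
        · exact .inl h'
        · exact .inr (h.trans h' hxu)
      · rintro (h' | h')
        · exact .inl h'
        · exact .inr ⟨h.trans h' (hx.2 u hxu), u, w, hxu, huw, hwy⟩
    -- every rank in the tree of `y` is at most `N`
    set N := Finset.univ.sup rk₁ with hN
    have hrk : ∀ v, rk₁ v < N + 1 := fun v =>
      Nat.lt_succ_of_le (Finset.le_sup (f := rk₁) (Finset.mem_univ v))
    have hey : ∀ v, C v y → v ≠ y → C (e₁ v) y := fun v hv hvy => (h₁ v hv hvy).1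
    refine ⟨fun v => if C v y then e₁ v else if v = u then w else e₂ v,
      fun v => if C v y then rk₁ v else N + 1 + rk₂ v,
      fun v => if C v y then ℓ₁ v else if v = u then c else ℓ₂ v, ?_, ?_⟩
    · intro v hv hvy
      rw [hiff] at hv
      rw [hiff]
      by_cases hvy' : C v y
      · obtain ⟨a, b, d⟩ := h₁ v hvy' hvy
        simp only [hvy', if_true, a, true_or, true_and]
        exact ⟨b, d.imp_right fun d => ⟨d.1, by omega, d.2.2⟩⟩
      · have hvu := hv.resolve_left hvy'
        by_cases hvu' : v = u
        · subst hvu'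
          simp only [hvy', if_false, if_true, hwy, true_or, true_and]
          refine ⟨by have := hrk w; omega, .inr ⟨huw, by omega, ?_⟩⟩
          rw [hKc]; exact hxu
        · obtain ⟨a, b, d⟩ := h₂ v hvu hvu'
          simp only [hvy', hvu', if_false]
          refine ⟨.inr a, ?_, d.imp_right fun d => ⟨d.1, by omega, d.2.2⟩⟩
          split_ifs
          · have := hrk (e₂ v); omega
          · omega
    · -- a vertex with the new label `c` is `u`; labels of the two parts never agree
      have cross : ∀ v₁ v₂, C v₁ y → v₁ ≠ y → e₁ v₁ ≠ f v₁ → C v₂ u → ¬ C v₂ y → v₂ ≠ u →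
          e₂ v₂ ≠ f v₂ → ℓ₁ v₁ ≠ ℓ₂ v₂ := by
        intro v₁ v₂ a₁ b₁ d₁ a₂ b₂ c₂ d₂ heq
        have k₁ := (h₁ v₁ a₁ b₁).2.2.resolve_left d₁
        have k₂ := (h₂ v₂ a₂ c₂).2.2.resolve_left d₂
        exact b₂ (h.trans (hK _ k₁.2.1 v₂ (heq ▸ k₂.2.2) v₁ k₁.2.2) a₁)
      intro v₁ v₂ a₁ b₁ d₁ a₂ b₂ d₂ heq
      rw [hiff] at a₁ a₂
      by_cases p₁ : C v₁ y <;> by_cases p₂ : C v₂ y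
      · simp only [p₁, p₂, if_true] at d₁ d₂ heq
        exact inj₁ v₁ v₂ p₁ b₁ d₁ p₂ b₂ d₂ heq
      · simp only [p₁, p₂, if_true, if_false] at d₁ d₂ heq
        by_cases q₂ : v₂ = u
        · have k₁ := (h₁ v₁ p₁ b₁).2.2.resolve_left d₁
          simp only [q₂, if_true] at heq
          omega
        · simp only [q₂, if_false] at d₂ heq
          exact absurd heq (cross v₁ v₂ p₁ b₁ d₁ (a₂.resolve_left p₂) p₂ q₂ d₂)
      · simp only [p₁, p₂, if_true, if_false] at d₁ d₂ heq
        by_cases q₁ : v₁ = u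
        · have k₂ := (h₁ v₂ p₂ b₂).2.2.resolve_left d₂
          simp only [q₁, if_true] at heq
          omega
        · simp only [q₁, if_false] at d₁ heq
          exact absurd heq.symm (cross v₂ v₁ p₂ b₂ d₂ (a₁.resolve_left p₁) p₁ q₁ d₁)
      · simp only [p₁, p₂, if_false] at d₁ d₂ heq
        have r₁ := a₁.resolve_left p₁
        have r₂ := a₂.resolve_left p₂
        by_cases q₁ : v₁ = u <;> by_cases q₂ : v₂ = u
        · rw [q₁, q₂]
        · simp only [q₁, q₂, if_true, if_false] at d₂ heq
          have k₂ := (h₂ v₂ r₂ q₂).2.2.resolve_left d₂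
          omega
        · simp only [q₁, q₂, if_true, if_false] at d₁ heq
          have k₁ := (h₂ v₁ r₁ q₁).2.2.resolve_left d₁
          omega
        · simp only [q₁, q₂, if_false] at d₁ d₂ heq
          exact inj₂ v₁ v₂ r₁ q₁ d₁ r₂ q₂ d₂ heq
  · -- no vertex is new among those that reach `y`
    have hiff : ∀ v, Arborescence.extend B C x v y ↔ C v y := by
      intro v
      refine ⟨?_, .inl⟩
      rintro (h' | ⟨h', hw⟩)
      · exact h'
      · by_contra hvy
        exact hy ⟨fun hxy => hvy (h.trans h' hxy), hw⟩
    obtain ⟨e, rk, ℓ, h₁, inj⟩ := ht y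
    refine ⟨e, rk, ℓ, fun v hv hvy => ?_, fun v₁ v₂ => ?_⟩
    · rw [hiff] at hv ⊢
      obtain ⟨a, b, d⟩ := h₁ v hv hvy
      exact ⟨a, b, d.imp_right fun d => ⟨d.1, by omega, d.2.2⟩⟩
    · rw [hiff, hiff]
      exact inj v₁ v₂

theorem HasLabelledTree.congr {K K' : ℕ → Set V} (hK : ∀ s < c, K s = K' s) {x : V}
    (h : HasLabelledTree f B c C K x) : HasLabelledTree f B c C K' x := by
  obtain ⟨e, rk, ℓ, h₁, inj⟩ := h
  refine ⟨e, rk, ℓ, fun v hv hvx => ?_, inj⟩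
  obtain ⟨a, b, d⟩ := h₁ v hv hvx
  exact ⟨a, b, d.imp_right fun d => ⟨d.1, d.2.1, by rw [← hK _ d.2.1]; exact d.2.2⟩⟩

theorem Grow.exists_hasLabelledTree [Fintype V] (h : Grow f B ρ c C) :
    ∃ K : ℕ → Set V, (∀ s < c, ∀ u ∈ K s, ∀ v ∈ K s, C u v) ∧
      ∀ x, HasLabelledTree f B c C K x := by
  induction h with
  | base => exact ⟨fun _ => ∅, fun s hs => absurd hs (Nat.not_lt_zero s), hasLabelledTree_base _⟩
  | @extend c C x h hx ih =>
    obtain ⟨K, hK, ht⟩ := ih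
    have hKK : ∀ s < c, K s = Function.update K c {j | C x j} s := fun s hs => by
      rw [Function.update_of_ne hs.ne]
    refine ⟨Function.update K c {j | C x j}, fun s hs u hu v hv => ?_, fun y => ?_⟩
    · rcases Nat.lt_succ_iff_lt_or_eq.1 hs with hs | rfl
      · rw [← hKK s hs] at hu hv
        exact .inl (hK s hs u hu v hv)
      · rw [Function.update_self] at hu hv
        exact .inl (h.trans (hx.2 u hu) hv)
    · refine HasLabelledTree.extend h hx (fun s hs => ?_) (by simp)
        (fun y => (ht y).congr hKK) y
      rw [← hKK s hs]
      exact hK s hs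

/-- Strong duality: once all vertices reach the root, there is a tree whose cost is the number of
rounds. -/
theorem Grow.exists_isTree [Fintype V] [DecidableEq V] (h : Grow f B ρ c C) (hρ : ∀ v, C v ρ) :
    ∃ e rk, IsTree f B ρ e rk ∧ cost f ρ e ≤ c := by
  obtain ⟨K, -, ht⟩ := h.exists_hasLabelledTree
  obtain ⟨e, rk, ℓ, h₁, inj⟩ := ht ρ
  refine ⟨e, rk, fun v hv => ?_, ?_⟩
  · obtain ⟨-, b, d⟩ := h₁ v (hρ v) hv
    exact ⟨d.imp_right fun d => d.1, b⟩
  · rw [← Finset.card_range c]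
    refine Finset.card_le_card_of_injOn ℓ (fun v hv => ?_) fun v₁ hv₁ v₂ hv₂ heq => ?_
    · simp only [Finset.coe_filter, Finset.mem_univ, true_and, Set.mem_ofPred_eq] at hv
      simpa using ((h₁ v (hρ v) hv.1).2.2.resolve_left hv.2).2.1
    · simp only [Finset.coe_filter, Finset.mem_univ, true_and, Set.mem_ofPred_eq] at hv₁ hv₂
      exact inj v₁ v₂ (hρ _) hv₁.1 hv₁.2 (hρ _) hv₂.1 hv₂.2 heq

theorem cost_lt_card [Fintype V] [DecidableEq V] (e : V → V) : cost f ρ e < Fintype.card V := by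
  refine Finset.card_lt_card ((Finset.ssubset_iff_of_subset (Finset.subset_univ _)).2
    ⟨ρ, Finset.mem_univ _, by simp⟩)

/-- The correctness of the rounds. After a number of rounds equal to the number of vertices, or
fewer if there is no sink component left, the number of rounds decides about the existence of a
cheap tree. -/
theorem Grow.exists_isTree_iff [Fintype V] [DecidableEq V] (h : Grow f B ρ c C)
    (hc : c = Fintype.card V ∨ ∀ x, ¬ IsSink C ρ x) (a k : ℕ) :
    (∃ e rk, IsTree f B ρ e rk ∧ a + cost f ρ e ≤ k) ↔ (∀ v, C v ρ) ∧ a + c ≤ k := by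
  refine ⟨?_, fun ⟨hρ, hk⟩ => ?_⟩
  · rintro ⟨e, rk, he, hk⟩
    refine ⟨fun v => ?_, (Nat.add_le_add_left (h.le_cost he) a).trans hk⟩
    by_contra hv
    obtain ⟨x, hx⟩ := exists_isSink h hv
    rcases hc with hc | hc
    · exact absurd (h.le_cost he) (by have := cost_lt_card (f := f) (ρ := ρ) e; omega)
    · exact hc x hx
  · obtain ⟨e, rk, he, hle⟩ := h.exists_isTree hρ
    exact ⟨e, rk, he, by omega⟩

/-- A vertex that is reached along free arcs is reached in fewer steps than there are vertices. -/
theorem exists_iterate_lt_card [Fintype V] {i j : V} (h : ∃ m, f^[m] i = j) :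
    ∃ m < Fintype.card V, f^[m] i = j := by
  classical
  refine ⟨Nat.find h, ?_, Nat.find_spec h⟩
  by_contra! hle
  obtain ⟨a, b, hab, heq⟩ := Fintype.exists_ne_map_eq_of_card_lt
    (fun a : Fin (Nat.find h + 1) => f^[(a : ℕ)] i) (by simpa using Nat.lt_succ_of_le hle)
  wlog hlt : a < b generalizing a b
  · exact this b a hab.symm heq.symm (lt_of_le_of_ne (not_lt.1 hlt) hab.symm)
  -- cutting out the steps between two visits of the same vertex gives a shorter way
  refine Nat.find_min h (m := Nat.find h - b + a) (by omega) ?_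
  rw [Function.iterate_add_apply]
  rw [heq, ← Function.iterate_add_apply, Nat.sub_add_cancel (by omega)]
  exact Nat.find_spec h

end Arborescence

/-! ### Weight maximization as a search for the voters outside the subtree -/

namespace LiquidDemocracy

open Arborescence

namespace WMaxPInstance

variable (I : WMaxPInstance)

/-- The free arcs when the voters in `S` stay outside the subtree of `iStar`. Voters keep their
delegation if it does not leave the subtree; otherwise they have no free arc, which is encoded by a
loop. The voters of `S` are joined to `iStar`, so that they play no role. -/
def freeArc (S : Finset (Fin I.n)) (v : Fin I.n) : Fin I.n :=
  if v ∈ S then I.iStar else if v = I.iStar then I.iStar else if I.d v ∈ S then v else I.d v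

/-- The arcs of the social network that may be used when the voters in `S` stay outside the
subtree. -/
def AllowedArc (S : Finset (Fin I.n)) (u w : Fin I.n) : Prop :=
  (u, w) ∈ I.A ∧ w ∉ S

/-- The voters whose delegation has to change whenever `iStar` is a guru and `S` is the set of
voters outside the subtree of `iStar`. -/
def forced (S : Finset (Fin I.n)) : Finset (Fin I.n) :=
  Finset.univ.filter fun v => v ∈ S ∧ I.d v ∉ S ∨ v = I.iStar ∧ I.d v ≠ v

/-- With the voters in `S` outside and all others inside the subtree of `iStar`, the threshold is
reached and the budget suffices. -/
def Good (S : Finset (Fin I.n)) : Prop :=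
  I.τ ≤ ∑ v ∈ Sᶜ, (I.ω v : ℕ) ∧ ∃ e rk, IsTree (I.freeArc S) (I.AllowedArc S) I.iStar e rk ∧
    (I.forced S).card + cost (I.freeArc S) I.iStar e ≤ I.k

variable {I}

theorem card_le_reqBar {S : Finset (Fin I.n)} (h : I.τ ≤ ∑ v ∈ Sᶜ, (I.ω v : ℕ)) :
    S.card ≤ I.reqBar := by
  have h₁ : S.card ≤ ∑ v ∈ S, (I.ω v : ℕ) := by
    rw [Finset.card_eq_sum_ones]
    exact Finset.sum_le_sum fun v _ => (I.ω v).pos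
  have h₂ := Finset.sum_add_sum_compl S fun v => (I.ω v : ℕ)
  unfold reqBar
  omega

/-- The set `S` consists of the voters outside the subtree of `iStar`; the arborescence follows the
new delegations. -/
theorem exists_good_of_isDelegation {d' : Fin I.n → Fin I.n} (hd' : IsDelegation I.A d')
    (hk : (Finset.univ.filter fun i => I.d i ≠ d' i).card ≤ I.k)
    (hτ : I.τ ≤ accWeight I.ω d' I.iStar) (hpos : I.τ ≠ 0) :
    ∃ S : Finset (Fin I.n), I.iStar ∉ S ∧ I.Good S := by
  classical
  have hroot : d' I.iStar = I.iStar := by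
    by_contra h
    rw [accWeight, if_neg h] at hτ
    omega
  rw [accWeight, if_pos hroot] at hτ
  have hmem : ∀ v, v ∉ (subtree d' I.iStar)ᶜ ↔
      Relation.ReflTransGen (DelegArc d') v I.iStar := by
    intro v
    simp [subtree]
  set S := (subtree d' I.iStar)ᶜ with hS
  have hin : ∀ v, v ∉ S → v ≠ I.iStar → d' v ≠ v ∧ d' v ∉ S := by
    intro v hv hne
    rw [hmem] at hv
    rcases hv.cases_head with h | ⟨c, ⟨hne', hvc⟩, h⟩
    · exact absurd h hne
    · subst hvc
      exact ⟨hne'.symm, (hmem _).2 h⟩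
  have hout : ∀ v, v ∈ S → d' v ∈ S := by
    intro v hv
    by_contra h
    have hne : v ≠ d' v := fun h' => h (h' ▸ hv)
    rw [hmem] at h
    exact (hmem v).2 (.head ⟨hne, rfl⟩ h) hv
  have hρ : I.iStar ∉ S := (hmem _).2 .refl
  have hreach : ∀ v, ∃ m, (fun v => if v ∈ S then I.iStar else d' v)^[m] v = I.iStar := by
    intro v
    by_cases hv : v ∈ S
    · exact ⟨1, by simp [hv]⟩
    · rw [hmem] at hv
      induction hv using Relation.ReflTransGen.head_induction_on with
      | refl => exact ⟨0, rfl⟩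
      | @head a b hab hb ih =>
        obtain ⟨m, hm⟩ := ih
        have ha : a ∉ S := (hmem a).2 (.head hab hb)
        exact ⟨m + 1, by rw [Function.iterate_succ_apply, if_neg ha, hab.2, hm]⟩
  obtain ⟨e, rk, ℓ, h, -⟩ := hasLabelledTree_base (B := I.AllowedArc S)
    (f := fun v => if v ∈ S then I.iStar else d' v) (fun _ => ∅) I.iStar
  have he : ∀ v, v ≠ I.iStar → e v = if v ∈ S then I.iStar else d' v := fun v hv =>
    (h v (hreach v) hv).2.2.resolve_right fun h' => absurd h'.2.1 (Nat.not_lt_zero _)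
  refine ⟨S, hρ, ?_, e, rk, fun v hv => ⟨?_, (h v (hreach v) hv).2.1⟩, ?_⟩
  · simpa [hS] using hτ
  · rw [he v hv]
    by_cases hvS : v ∈ S
    · simp [hvS, freeArc]
    · rw [if_neg hvS]
      exact .inr ⟨hd'.1 v (hin v hvS hv).1, (hin v hvS hv).2⟩
  · have hcost : ∀ v, v ≠ I.iStar → e v ≠ I.freeArc S v → v ∉ S ∧ I.d v ≠ d' v := by
      intro v hv hne
      rw [he v hv] at hne
      by_cases hvS : v ∈ S
      · simp [hvS, freeArc] at hne
      · refine ⟨hvS, fun heq => hne ?_⟩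
        have := (hin v hvS hv).2
        simp [freeArc, hvS, hv, heq, this]
    refine le_trans ?_ hk
    rw [cost, ← Finset.card_union_of_disjoint]
    · refine Finset.card_le_card fun v hv => ?_
      simp only [forced, Finset.mem_union, Finset.mem_filter, Finset.mem_univ, true_and] at hv ⊢
      rcases hv with (⟨h₁, h₂⟩ | ⟨rfl, h₂⟩) | ⟨h₁, h₂⟩
      · exact fun h' => h₂ (h' ▸ hout v h₁)
      · rwa [hroot]
      · exact (hcost v h₁ h₂).2
    · rw [Finset.disjoint_left]
      intro v hv hv'
      simp only [forced, Finset.mem_filter, Finset.mem_univ, true_and] at hv hv'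
      rcases hv with ⟨h₁, -⟩ | ⟨h₁, -⟩
      · exact (hcost v hv'.1 hv'.2).1 h₁
      · exact hv'.1 h₁

/-- Outside the subtree, voters keep their delegation if it stays outside, and vote directly
otherwise. -/
theorem Good.isYes {S : Finset (Fin I.n)} (hρ : I.iStar ∉ S) (hS : I.Good S) : I.IsYes := by
  classical
  obtain ⟨hτ, e, rk, he, hk⟩ := hS
  have key : ∀ v, v ∉ S → v ≠ I.iStar → e v ≠ v ∧ e v ∉ S ∧ (v, e v) ∈ I.A ∧
      (e v = I.freeArc S v → I.d v = e v) := by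
    intro v hv hne
    obtain ⟨h₁, h₂⟩ := he v hne
    have hev : e v ≠ v := fun h' => by rw [h'] at h₂; exact lt_irrefl _ h₂
    have hfree : e v = I.freeArc S v → I.d v = e v ∧ e v ∉ S := by
      intro h'
      by_cases hd : I.d v ∈ S
      · simp [freeArc, hv, hne, hd] at h'
        exact absurd h' hev
      · simp [freeArc, hv, hne, hd] at h'
        exact ⟨h'.symm, h' ▸ hd⟩
    refine ⟨hev, ?_, ?_, fun h' => (hfree h').1⟩
    · exact h₁.elim (fun h' => (hfree h').2) fun h' => h'.2
    · refine h₁.elim (fun h' => ?_) fun h' => h'.1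
      rw [← (hfree h').1]
      exact I.isDelegation.1 v ((hfree h').1 ▸ hev)
  set d' : Fin I.n → Fin I.n := fun v =>
    if v ∈ S then if I.d v ∈ S then I.d v else v else if v = I.iStar then I.iStar else e v with hd'
  have harc : ∀ a b, DelegArc d' a b →
      (a ∈ S ∧ b ∈ S ∧ DelegArc I.d a b) ∨ (a ∉ S ∧ b ∉ S ∧ rk b < rk a) := by
    rintro a b ⟨hne, rfl⟩
    by_cases ha : a ∈ S
    · by_cases hda : I.d a ∈ S
      · have : d' a = I.d a := by simp [hd', ha, hda]
        rw [this] at hne ⊢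
        exact .inl ⟨ha, hda, hne, rfl⟩
      · exact absurd (by simp [hd', ha, hda]) hne
    · by_cases haρ : a = I.iStar
      · exact absurd (by simp [hd', haρ, hρ]) hne
      · have : d' a = e a := by simp [hd', ha, haρ]
        rw [this]
        exact .inr ⟨ha, (key a ha haρ).2.1, (he a haρ).2⟩
  have htrans : ∀ a b, Relation.TransGen (DelegArc d') a b →
      (a ∈ S ∧ b ∈ S ∧ Relation.TransGen (DelegArc I.d) a b) ∨
        (a ∉ S ∧ b ∉ S ∧ rk b < rk a) := by
    intro a b h
    induction h with
    | single h => exact (harc _ _ h).imp_left fun h' => ⟨h'.1, h'.2.1, .single h'.2.2⟩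
    | tail _ h ih =>
      rcases ih with ih | ih <;> rcases harc _ _ h with h' | h'
      · exact .inl ⟨ih.1, h'.2.1, ih.2.2.tail h'.2.2⟩
      · exact absurd ih.2.1 h'.1
      · exact absurd h'.1 ih.2.1
      · exact .inr ⟨ih.1, h'.2.1, h'.2.2.trans ih.2.2⟩
  refine ⟨d', ⟨fun v hv => ?_, fun v hv => ?_⟩, le_trans (Finset.card_le_card ?_)
    ((Finset.card_union_le _ _).trans hk), ?_⟩
  · by_cases hvS : v ∈ S
    · by_cases hda : I.d v ∈ S
      · have h' : d' v = I.d v := by simp [hd', hvS, hda]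
        rw [h'] at hv ⊢
        exact I.isDelegation.1 v hv
      · exact absurd (by simp [hd', hvS, hda]) hv
    · by_cases hvρ : v = I.iStar
      · exact absurd (by simp [hd', hvρ, hρ]) hv
      · have h' : d' v = e v := by simp [hd', hvS, hvρ]
        rw [h']
        exact (key v hvS hvρ).2.2.1
  · rcases htrans v v hv with h | h
    · exact I.isDelegation.2 v h.2.2
    · exact lt_irrefl _ h.2.2
  · intro v hv
    simp only [forced, Finset.mem_union, Finset.mem_filter, Finset.mem_univ, true_and] at hv ⊢
    by_cases hvS : v ∈ S
    · by_cases hda : I.d v ∈ S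
      · exact absurd (by simp [hd', hvS, hda]) hv
      · exact .inl (.inl ⟨hvS, hda⟩)
    · by_cases hvρ : v = I.iStar
      · refine .inl (.inr ⟨hvρ, ?_⟩)
        have h' : d' v = v := by simp [hd', hvρ, hρ]
        rwa [h'] at hv
      · have h' : d' v = e v := by simp [hd', hvS, hvρ]
        rw [h'] at hv
        exact .inr ⟨hvρ, fun h' => hv ((key v hvS hvρ).2.2.2 h')⟩
  · have hroot : d' I.iStar = I.iStar := by simp [hd', hρ]
    rw [accWeight, if_pos hroot]
    refine hτ.trans (Finset.sum_le_sum_of_subset fun v hv => ?_)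
    rw [Finset.mem_compl] at hv
    simp only [subtree, Finset.mem_filter, Finset.mem_univ, true_and]
    induction hr : rk v using Nat.strong_induction_on generalizing v with
    | _ r ih =>
      by_cases hvρ : v = I.iStar
      · rw [hvρ]
      · have h' : d' v = e v := by simp [hd', hv, hvρ]
        exact .head ⟨(key v hv hvρ).1.symm, h'⟩
          (ih _ (hr ▸ (he v hvρ).2) (e v) (key v hv hvρ).2.1 rfl)

variable (I)

/-- If the threshold is zero, nothing has to be changed; this case is separate because then `iStar`
need not be a guru. -/
theorem isYes_iff_exists_good :
    I.IsYes ↔ I.τ = 0 ∨ ∃ S : Finset (Fin I.n), I.iStar ∉ S ∧ I.Good S := by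
  constructor
  · rintro ⟨d', hd', hk, hτ⟩
    by_cases hpos : I.τ = 0
    · exact .inl hpos
    · exact .inr (exists_good_of_isDelegation hd' hk hτ hpos)
  · rintro (h | ⟨S, hρ, hS⟩)
    · exact ⟨I.d, I.isDelegation, by simp, by simp [h]⟩
    · exact hS.isYes hρ

/-- The set of voters encoded by the first `r` base-`n` digits of `m`. The digit `iStar` stands for
no voter. -/
def digitSet (r m : ℕ) : Finset (Fin I.n) :=
  Finset.univ.filter fun v => v ≠ I.iStar ∧ ∃ j < r, m / I.n ^ j % I.n = v

theorem exists_digitSet_eq (r : ℕ) (S : Finset (Fin I.n)) (hS : I.iStar ∉ S) (hr : S.card ≤ r) :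
    ∃ m < I.n ^ r, I.digitSet r m = S := by
  induction r generalizing S with
  | zero =>
    obtain rfl := Finset.card_eq_zero.1 (Nat.le_zero.1 hr)
    exact ⟨0, by simp, by simp [digitSet]⟩
  | succ r ih =>
    have ha : ∃ a : Fin I.n, (S.erase a).card ≤ r ∧ (a ∈ S ∨ a = I.iStar) := by
      rcases S.eq_empty_or_nonempty with rfl | ⟨a, ha⟩
      · exact ⟨I.iStar, by simp, .inr rfl⟩
      · exact ⟨a, by rw [Finset.card_erase_of_mem ha]; omega, .inl ha⟩
    obtain ⟨a, hcard, ha⟩ := ha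
    obtain ⟨m, hm, hmS⟩ := ih (S.erase a) (fun h => hS (Finset.mem_of_mem_erase h)) hcard
    have h0 : (m * I.n + a) % I.n = a := by
      rw [Nat.mul_add_mod', Nat.mod_eq_of_lt a.2]
    have hdiv : (m * I.n + a) / I.n = m := by
      rw [mul_comm, Nat.mul_add_div (lt_of_le_of_lt (Nat.zero_le _) a.2), Nat.div_eq_of_lt a.2,
        add_zero]
    have hsucc : ∀ j, (m * I.n + a) / I.n ^ (j + 1) % I.n = m / I.n ^ j % I.n := by
      intro j
      rw [pow_succ', ← Nat.div_div_eq_div_mul, hdiv]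
    refine ⟨m * I.n + a, ?_, ?_⟩
    · calc m * I.n + a < m * I.n + I.n := by have := a.2; omega
        _ = (m + 1) * I.n := by ring
        _ ≤ I.n ^ r * I.n := Nat.mul_le_mul_right _ hm
        _ = I.n ^ (r + 1) := (pow_succ _ _).symm
    · ext v
      have hv : v ∈ I.digitSet r m ↔ v ∈ S.erase a := by rw [hmS]
      simp only [digitSet, Finset.mem_filter, Finset.mem_univ, true_and, Finset.mem_erase] at hv ⊢
      constructor
      · rintro ⟨hvρ, j, hj, hjv⟩
        rcases j with _ | j
        · rw [pow_zero, Nat.div_one, h0] at hjv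
          obtain rfl := Fin.ext hjv
          exact ha.resolve_right hvρ
        · rw [hsucc] at hjv
          exact (hv.1 ⟨hvρ, j, by omega, hjv⟩).2
      · intro hvS
        have hvρ : v ≠ I.iStar := fun h => hS (h ▸ hvS)
        by_cases hva : v = a
        · exact ⟨hvρ, 0, by omega, by rw [pow_zero, Nat.div_one, h0, hva]⟩
        · obtain ⟨-, j, hj, hjv⟩ := hv.2 ⟨hva, hvS⟩
          exact ⟨hvρ, j + 1, by omega, by rw [hsucc, hjv]⟩

/-- There are only `n ^ reqBar` candidates for the set of voters outside the subtree. -/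
theorem isYes_iff_exists_digitSet :
    I.IsYes ↔ I.τ = 0 ∨ ∃ m < I.n ^ I.reqBar, I.Good (I.digitSet I.reqBar m) := by
  rw [isYes_iff_exists_good]
  refine or_congr_right ⟨?_, ?_⟩
  · rintro ⟨S, hρ, hS⟩
    obtain ⟨m, hm, rfl⟩ := I.exists_digitSet_eq I.reqBar S hρ (card_le_reqBar hS.1)
    exact ⟨m, hm, hS⟩
  · rintro ⟨m, -, hS⟩
    exact ⟨_, by simp [digitSet], hS⟩

end WMaxPInstance

end LiquidDemocracy

/-! ### Straight-line code, conditions and loops over the voters -/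

namespace RAM

/-- Sequential composition of a list of programs. -/
def Prog.block : List Prog → Prog
  | [] => .skip
  | p :: l => .seq p (block l)

/-- A test for inequality of two expressions. -/
def Expr.neTest (e₁ e₂ : Expr) : Expr := .add (.sub e₁ e₂) (.sub e₂ e₁)

theorem Expr.val_neTest {e₁ e₂ : Expr} {s : State} :
    (neTest e₁ e₂).val s ≠ 0 ↔ e₁.val s ≠ e₂.val s := by
  simp only [neTest, Expr.val]
  omega

variable {M : ℕ} {s : State} {Q : State → Prop}

@[simp] theorem wp_skip : wp M .skip s Q ↔ Q s := Iff.rfl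

@[simp] theorem wp_assign {r : ℕ} {e : Expr} :
    wp M (.assign r e) s Q ↔ Q (s.setR r (e.val s)) := Iff.rfl

@[simp] theorem wp_store {a : ℕ} {i e : Expr} :
    wp M (.store a i e) s Q ↔ Q (s.setA a (i.val s) (e.val s)) := Iff.rfl

@[simp] theorem wp_block_nil : wp M (.block []) s Q ↔ Q s := Iff.rfl

@[simp] theorem wp_block_assign {r : ℕ} {e : Expr} {l : List Prog} :
    wp M (.block (.assign r e :: l)) s Q ↔ wp M (.block l) (s.setR r (e.val s)) Q := Iff.rfl

@[simp] theorem wp_block_store {a : ℕ} {i e : Expr} {l : List Prog} :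
    wp M (.block (.store a i e :: l)) s Q ↔ wp M (.block l) (s.setA a (i.val s) (e.val s)) Q :=
  Iff.rfl

theorem wp.block {p : Prog} {l : List Prog} {R : State → Prop} (h : wp M p s R)
    (h' : ∀ s', Frame p s s' → R s' → wp M (.block l) s' Q) : wp M (.block (p :: l)) s Q :=
  h.frame.mono fun s' hs' => h' s' hs'.1 hs'.2

theorem wp_ite {e : Expr} {p q : Prog} {P : Prop} (hP : e.val s ≠ 0 ↔ P) :
    wp M (.ite e p q) s Q ↔ (P → wp M p s Q) ∧ (¬ P → wp M q s Q) := by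
  rw [← hP, not_not]
  rfl

/-- The invariant rule for `for` loops over `Fin n`. -/
theorem wp_forFin {n i b : ℕ} {p : Prog} (J : ℕ → State → Prop)
    (hN : s.reg b = n) (hNM : n ≤ M) (zero : J 0 (s.setR i 0))
    (step : ∀ (v : Fin n) s', s'.reg i = (v : ℕ) → Frame (.forLt i b p) s s' → J v s' →
      wp M p s' fun s'' => J (v + 1) (s''.setR i (v + 1)))
    (post : ∀ s', Frame (.forLt i b p) s s' → J n s' → Q s')
    (hbi : b ≠ i := by decide) (hb : b ∉ p.regs := by decide) (hi : i ∉ p.regs := by decide) :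
    wp M (.forLt i b p) s Q :=
  wp_forLt J hN hNM hbi hb hi zero (fun j s' hj => step ⟨j, hj⟩ s') post

end RAM

/-- The sum of the first `j` values of `g`. -/
def partialSum {n : ℕ} (g : Fin n → ℕ) (j : ℕ) : ℕ :=
  ∑ v : Fin n, if (v : ℕ) < j then g v else 0

@[simp] theorem partialSum_zero {n : ℕ} (g : Fin n → ℕ) : partialSum g 0 = 0 := by
  simp [partialSum]

theorem partialSum_succ {n : ℕ} (g : Fin n → ℕ) (v : Fin n) :
    partialSum g (v + 1) = partialSum g v + g v := by
  have h : ∀ w : Fin n, (if (w : ℕ) < v + 1 then g w else 0) =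
      (if (w : ℕ) < v then g w else 0) + if w = v then g w else 0 := by
    intro w
    have := Fin.ext_iff (a := w) (b := v)
    split_ifs <;> omega
  simp only [partialSum, h, Finset.sum_add_distrib, Finset.sum_ite_eq', Finset.mem_univ, if_true]

theorem partialSum_self {n : ℕ} (g : Fin n → ℕ) : partialSum g n = ∑ v, g v := by
  simp [partialSum]

/-- The position of the entry in row `u` and column `v` of an `n × n` matrix. -/
def cell {n : ℕ} (u v : Fin n) : ℕ := u * n + v

theorem cell_inj {n : ℕ} {u v u' v' : Fin n} : cell u v = cell u' v' ↔ u = u' ∧ v = v' := by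
  refine ⟨fun h => ?_, by rintro ⟨rfl, rfl⟩; rfl⟩
  have hv : (v : ℕ) = v' := by
    have := congrArg (· % n) h
    simpa [cell, Nat.mod_eq_of_lt] using this
  have hu : (u : ℕ) = u' := by
    simp only [cell, hv, Nat.add_right_cancel_iff] at h
    exact Nat.eq_of_mul_eq_mul_right (lt_of_le_of_lt (Nat.zero_le _) v.2) h
  exact ⟨Fin.ext hu, Fin.ext hv⟩

theorem List.getElem?_flatMap_of_length {α β : Type*} {n : ℕ} (l : List α) (g : α → List β)
    (hg : ∀ a, (g a).length = n) (i j : ℕ) (hj : j < n) :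
    (l.flatMap g)[i * n + j]? = l[i]?.bind fun a => (g a)[j]? := by
  induction l generalizing i with
  | nil => simp
  | cons a l ih =>
    rw [List.flatMap_cons]
    rcases i with _ | i
    · rw [List.getElem?_append_left (by rw [hg]; omega)]
      simp
    · rw [List.getElem?_append_right (by rw [hg, Nat.succ_mul]; omega), hg, Nat.succ_mul,
        show i * n + n + j - n = i * n + j by omega, ih]
      simp

namespace LiquidDemocracy.WMaxPInstance

open RAM Arborescence

variable (I : WMaxPInstance)

theorem n_pos : 0 < I.n := lt_of_le_of_lt (Nat.zero_le _) I.iStar.2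

theorem encode_weight (v : Fin I.n) : I.encode[4 + (v : ℕ)]?.getD 0 = I.ω v := by
  have : I.encode[4 + (v : ℕ)]? = some (I.ω v : ℕ) := by
    rw [encode, List.getElem?_append_left (by simp; omega),
      List.getElem?_append_left (by simp; omega),
      List.getElem?_append_right (by simp)]
    simp
  rw [this, Option.getD_some]

theorem encode_deleg (v : Fin I.n) : I.encode[4 + I.n + (v : ℕ)]?.getD 0 = I.d v := by
  have : I.encode[4 + I.n + (v : ℕ)]? = some (I.d v : ℕ) := by
    rw [encode, List.getElem?_append_left (by simp; omega),
      List.getElem?_append_right (by simp; omega)]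
    simp only [List.length_append, List.length_cons, List.length_nil, List.length_map,
      List.length_finRange]
    rw [show 4 + I.n + (v : ℕ) - (0 + 1 + 1 + 1 + 1 + I.n) = v by omega]
    simp
  rw [this, Option.getD_some]

theorem encode_adj (u v : Fin I.n) :
    I.encode[4 + I.n + I.n + cell u v]?.getD 0 = if (u, v) ∈ I.A then 1 else 0 := by
  have : I.encode[4 + I.n + I.n + cell u v]? = some (if (u, v) ∈ I.A then 1 else 0) := by
    rw [encode, List.getElem?_append_right (by simp; omega)]
    simp only [List.length_append, List.length_cons, List.length_nil, List.length_map,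
      List.length_finRange]
    rw [show 4 + I.n + I.n + cell u v - (0 + 1 + 1 + 1 + 1 + I.n + I.n) = u * I.n + v by
      simp only [cell]; omega]
    rw [List.getElem?_flatMap_of_length _ _ (fun a => by simp) _ _ v.2]
    simp
  rw [this, Option.getD_some]

end LiquidDemocracy.WMaxPInstance

/-! ### The memory layout, reading the input -/

namespace LiquidDemocracy.WMaxPInstance

open RAM Arborescence

-- The registers and arrays of the program. `R_x` and `R_q` are the current number or vertex and a
-- quotient or accumulated sum, `R_deleg` is the delegate of the current voter. Row `u` of an
-- `n × n` matrix starts at position `u * n`, which is stored in `A_row`, as the machine cannot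
-- multiply.
local notation "R_n" => (1 : ℕ)
local notation "R_root" => (2 : ℕ)
local notation "R_req" => (3 : ℕ)
local notation "R_ans" => (4 : ℕ)
local notation "R_count" => (5 : ℕ)
local notation "R_guess" => (6 : ℕ)
local notation "R_i" => (7 : ℕ)
local notation "R_j" => (8 : ℕ)
local notation "R_x" => (9 : ℕ)
local notation "R_q" => (10 : ℕ)
local notation "R_cost" => (11 : ℕ)
local notation "R_weight" => (12 : ℕ)
local notation "R_deleg" => (13 : ℕ)
local notation "R_found" => (14 : ℕ)
local notation "R_ok" => (15 : ℕ)
local notation "R_sink" => (16 : ℕ)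
local notation "R_w" => (17 : ℕ)
local notation "R_round" => (18 : ℕ)
local notation "A_input" => (0 : ℕ)
local notation "A_row" => (1 : ℕ)
local notation "A_mask" => (2 : ℕ)
local notation "A_free" => (3 : ℕ)
local notation "A_reach" => (4 : ℕ)
local notation "A_target" => (5 : ℕ)

/-- The weight of the voter in register `i`. -/
def weightExpr (i : ℕ) : Expr := .arr A_input (.add (.const 4) (.reg i))

/-- The delegate of the voter in register `i`. -/
def delegExpr (i : ℕ) : Expr := .arr A_input (.add (.add (.const 4) (.reg R_n)) (.reg i))

/-- The position of the matrix entry whose row and column are in registers `i` and `j`. -/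
def cellExpr (i j : ℕ) : Expr := .add (.arr A_row (.reg i)) (.reg j)

/-- The entry of the adjacency matrix whose row and column are in registers `i` and `j`. -/
def adjExpr (i j : ℕ) : Expr :=
  .arr A_input (.add (.add (.add (.const 4) (.reg R_n)) (.reg R_n)) (cellExpr i j))

/-- The entry of the reachability matrix whose row and column are in registers `i` and `j`. -/
def reachExpr (i j : ℕ) : Expr := .arr A_reach (cellExpr i j)

/-- The part of the memory that does not change after the input has been read. -/
structure Env (I : WMaxPInstance) (s : State) : Prop where
  n : s.reg R_n = I.n
  root : s.reg R_root = I.iStar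
  req : s.reg R_req = I.reqBar
  count : s.reg R_count = I.n ^ I.reqBar
  budget : s.arr A_input 2 = I.k
  threshold : s.arr A_input 3 = I.τ
  weight : ∀ v : Fin I.n, s.arr A_input (4 + v) = I.ω v
  deleg : ∀ v : Fin I.n, s.arr A_input (4 + I.n + v) = I.d v
  adj : ∀ u v : Fin I.n,
    s.arr A_input (4 + I.n + I.n + cell u v) = if (u, v) ∈ I.A then 1 else 0
  row : ∀ u : Fin I.n, s.arr A_row u = u * I.n

variable {I : WMaxPInstance} {s s' : State} {M : ℕ}

theorem Env.frame (h : Env I s) {p : Prog} (hF : Frame p s s')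
    (hr : ∀ r ∈ p.regs, r = 4 ∨ 5 < r := by decide) (ha : ∀ a ∈ p.arrs, 1 < a := by decide) :
    Env I s' := by
  have reg : ∀ r, r ≠ 4 → r ≤ 5 → s'.reg r = s.reg r := fun r h₁ h₂ =>
    hF.reg r fun h => by have := hr r h; omega
  have arr : ∀ a ≤ 1, s'.arr a = s.arr a := fun a h' =>
    hF.arr a fun h => absurd (ha a h) (by omega)
  obtain ⟨h₁, h₂, h₃, h₄, h₅, h₆, h₇, h₈, h₉, h₁₀⟩ := h
  constructor <;> simp only [reg _ (by decide : (1 : ℕ) ≠ 4), reg _ (by decide : (2 : ℕ) ≠ 4),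
    reg _ (by decide : (3 : ℕ) ≠ 4), reg _ (by decide : (5 : ℕ) ≠ 4), Nat.reduceLeDiff,
    arr 0 (by decide), arr 1 (by decide)] <;> assumption

/-- Read the input, compute the parameter and the number of candidate sets; the answer is
initially positive if the threshold is zero. -/
def setupProg : Prog := .block [
  .assign R_n (.arr A_input (.const 0)),
  .assign R_root (.arr A_input (.const 1)),
  .assign R_weight (.const 0),
  .forLt R_i R_n (.assign R_weight (.add (.reg R_weight) (weightExpr R_i))),
  .assign R_req (.sub (.reg R_weight) (.arr A_input (.const 3))),
  .assign R_q (.const 0),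
  .forLt R_i R_n (.block [
    .store A_row (.reg R_i) (.reg R_q),
    .assign R_q (.add (.reg R_q) (.reg R_n))]),
  .assign R_count (.const 1),
  .forLt R_i R_req (.block [
    .assign R_q (.const 0),
    .forLt R_j R_n (.assign R_q (.add (.reg R_q) (.reg R_count))),
    .assign R_count (.reg R_q)]),
  .assign R_ans (.sub (.const 1) (.arr A_input (.const 3)))]

theorem setupProg_spec (hn : I.n ≤ M) (hreq : I.reqBar ≤ M) :
    wp M setupProg (initState I.encode)
      fun s => Env I s ∧ s.reg R_ans = 1 - I.τ := by
  set s₀ := initState I.encode with hs₀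
  have harr : ∀ i, s₀.arr 0 i = I.encode[i]?.getD 0 := fun i => List.getD_eq_getElem?_getD
  have h0 : s₀.arr 0 0 = I.n := rfl
  have h1 : s₀.arr 0 1 = I.iStar := rfl
  have h2 : s₀.arr 0 2 = I.k := rfl
  have h3 : s₀.arr 0 3 = I.τ := rfl
  unfold setupProg
  simp only [wp_block_assign, Expr.val, State.setR_arr, h0, h1]
  refine wp.block (R := fun s => s.reg R_weight = ∑ v, (I.ω v : ℕ))
    (wp_forFin (n := I.n) (fun j s => s.reg R_weight = partialSum (fun v => (I.ω v : ℕ)) j)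
      (by simp) hn (by simp) (fun v s hv hF hJ => ?_) (fun s hF hJ => ?_)) fun s₁ hF₁ hs₁ => ?_
  · have ha : s.arr 0 = s₀.arr 0 := hF.arr 0 (by decide)
    simp [weightExpr, Expr.val, hJ, partialSum_succ, ha, hv, harr, encode_weight]
  · rw [hJ, partialSum_self]
  have hn₁ : s₁.reg R_n = I.n := by rw [hF₁.reg _ (by decide)]; simp
  have hr₁ : s₁.reg R_root = I.iStar := by rw [hF₁.reg _ (by decide)]; simp
  have ha₁ : s₁.arr 0 = s₀.arr 0 := hF₁.arr 0 (by decide)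
  have hreq₁ : s₁.reg R_weight - s₁.arr 0 3 = I.reqBar := by rw [hs₁, ha₁, h3]; rfl
  simp only [wp_block_assign, Expr.val, hreq₁]
  refine wp.block (R := fun s => ∀ u : Fin I.n, s.arr A_row u = u * I.n)
    (wp_forFin (n := I.n) (fun j s => s.reg R_q = j * I.n ∧
        ∀ u : Fin I.n, (u : ℕ) < j → s.arr A_row u = u * I.n)
      (by simp [hn₁]) hn (by simp) (fun v s hv hF hJ => ?_) (fun s hF hJ u => hJ.2 u u.2))
    fun s₂ hF₂ hs₂ => ?_
  · have hn' : s.reg R_n = I.n := by rw [hF.reg _ (by decide)]; simp [hn₁]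
    simp only [wp_block_assign, wp_block_store, wp_block_nil, Expr.val]
    refine ⟨by simp [hJ.1, hn', Nat.succ_mul], fun u hu => ?_⟩
    by_cases huv : (u : ℕ) = v
    · simp [hv, huv, hJ.1]
    · simp [hv, huv, hJ.2 u (by omega)]
  have hn₂ : s₂.reg R_n = I.n := by rw [hF₂.reg _ (by decide)]; simp [hn₁]
  have hr₂ : s₂.reg R_root = I.iStar := by rw [hF₂.reg _ (by decide)]; simp [hr₁]
  have hq₂ : s₂.reg R_req = I.reqBar := by rw [hF₂.reg _ (by decide)]; simp
  have ha₂ : s₂.arr 0 = s₀.arr 0 := (hF₂.arr 0 (by decide)).trans ha₁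
  simp only [wp_block_assign, Expr.val]
  refine wp.block (R := fun s => s.reg R_count = I.n ^ I.reqBar)
    (wp_forLt (N := I.reqBar) (fun j s => s.reg R_count = I.n ^ j)
      (by simp [hq₂]) hreq (by decide) (by decide) (by decide) (by simp)
      (fun j s hj hij hF hJ => ?_) (fun s hF hJ => hJ))
    fun s₃ hF₃ hs₃ => ?_
  · have hn' : s.reg R_n = I.n := by rw [hF.reg _ (by decide)]; simp [hn₂]
    simp only [wp_block_assign, Expr.val]
    refine wp.block (R := fun s => s.reg R_q = I.n ^ (j + 1))
      (wp_forLt (N := I.n) (fun k s => s.reg R_q = k * I.n ^ j)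
        (by simp [hn']) hn (by decide) (by decide) (by decide) (by simp)
        (fun k s' hk hik hF' hJ' => ?_) (fun s' hF' hJ' => ?_)) fun s' hF' hs' => ?_
    · have hc : s'.reg R_count = I.n ^ j := by rw [hF'.reg _ (by decide)]; simp [hJ]
      simp [Expr.val, hJ', hc, Nat.succ_mul]
    · rw [hJ', pow_succ']
    · simp [Expr.val, hs']
  have ha₃ : s₃.arr 0 = s₀.arr 0 := (hF₃.arr 0 (by decide)).trans ha₂
  have hrow₃ : s₃.arr 1 = s₂.arr 1 := hF₃.arr 1 (by decide)
  simp only [wp_block_assign, wp_block_nil, Expr.val]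
  refine ⟨⟨?_, ?_, ?_, ?_, ?_, ?_, ?_, ?_, ?_, ?_⟩, by simp [ha₃, h3]⟩
  · simp [hF₃.reg R_n (by decide), hn₂]
  · simp [hF₃.reg R_root (by decide), hr₂]
  · simp [hF₃.reg R_req (by decide), hq₂]
  · simp [hs₃]
  · simp [ha₃, h2]
  · simp [ha₃, h3]
  · simp [ha₃, harr, encode_weight]
  · simp [ha₃, harr, encode_deleg]
  · simp [ha₃, harr, encode_adj]
  · simpa [hrow₃] using hs₂

/-! ### Decoding a candidate set -/

/-- Division with remainder by the content of register `R_n`: the remainder replaces the dividend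
in `R_x` and the quotient is put into `R_q`. -/
def divModProg : Prog := .block [
  .assign R_q (.const 0),
  .loop (.sub (.add (.reg R_x) (.const 1)) (.reg R_n)) (.block [
    .assign R_x (.sub (.reg R_x) (.reg R_n)),
    .assign R_q (.add (.reg R_q) (.const 1))])]

theorem divModProg_spec {n : ℕ} (hpos : 0 < n) (hn : s.reg R_n = n) (hM : s.reg R_x ≤ M) :
    wp M divModProg s fun s' => s'.reg R_x = s.reg R_x % n ∧ s'.reg R_q = s.reg R_x / n := by
  refine ⟨s.reg R_x / n, (Nat.div_le_self _ _).trans hM, ?_⟩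
  have H : ∀ k (s₁ : State), s₁.reg R_n = n → s₁.reg R_x / n = k →
      s₁.reg R_x % n = s.reg R_x % n → s₁.reg R_q + k = s.reg R_x / n →
      Nat.rec (motive := fun _ => State → Prop)
      (fun s' => (Expr.sub (.add (.reg R_x) (.const 1)) (.reg R_n)).val s' = 0 ∧
        (s'.reg R_x = s.reg R_x % n ∧ s'.reg R_q = s.reg R_x / n))
      (fun _ R s' => (Expr.sub (.add (.reg R_x) (.const 1)) (.reg R_n)).val s' ≠ 0 ∧
        wp M (.block [
          .assign R_x (.sub (.reg R_x) (.reg R_n)),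
          .assign R_q (.add (.reg R_q) (.const 1))]) s' R) k s₁ := by
    intro k
    induction k with
    | zero =>
      intro s₁ h₁ h₂ h₃ h₄
      have hlt : s₁.reg R_x < n := by
        rcases Nat.div_eq_zero_iff.1 h₂ with h | h <;> omega
      rw [Nat.mod_eq_of_lt hlt] at h₃
      refine ⟨?_, h₃, h₄⟩
      simp only [Expr.val]
      omega
    | succ k ih =>
      intro s₁ h₁ h₂ h₃ h₄
      have hle : n ≤ s₁.reg R_x := by
        by_contra! h
        rw [Nat.div_eq_of_lt h] at h₂
        omega
      refine ⟨by simp only [Expr.val]; omega, ?_⟩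
      simp only [wp_block_assign, wp_block_nil, Expr.val]
      refine ih _ (by simpa using h₁) ?_ ?_ (by simp; omega)
      · have := Nat.div_eq_sub_div hpos hle
        simp [h₁]
        omega
      · rw [← h₃, Nat.mod_eq_sub_mod hle]
        simp [h₁]
  refine H _ _ ?_ ?_ ?_ ?_ <;> simp [hn, Expr.val]

/-- Mark the candidate set encoded by `R_guess` in the array `A_mask`. -/
def maskProg : Prog := .block [
  .forLt R_i R_n (.store A_mask (.reg R_i) (.const 0)),
  .assign R_x (.reg R_guess),
  .forLt R_i R_req (.block [
    divModProg,
    .store A_mask (.reg R_x) (.const 1),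
    .assign R_x (.reg R_q)]),
  .store A_mask (.reg R_root) (.const 0)]

/-- The array `A_mask` is the indicator of `S`. -/
def IsMask (I : WMaxPInstance) (S : Finset (Fin I.n)) (s : State) : Prop :=
  ∀ v : Fin I.n, s.arr A_mask v ≠ 0 ↔ v ∈ S

theorem maskProg_spec (hE : Env I s) (hn : I.n ≤ M) (hreq : I.reqBar ≤ M)
    (hM : s.reg R_guess ≤ M) :
    wp M maskProg s (IsMask I (I.digitSet I.reqBar (s.reg R_guess))) := by
  unfold maskProg
  refine wp.block (R := fun s => ∀ v : Fin I.n, s.arr A_mask v = 0)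
    (wp_forFin (n := I.n) (fun j s => ∀ v : Fin I.n, (v : ℕ) < j → s.arr A_mask v = 0)
      hE.n hn (by simp) (fun v s' hv hF hJ => ?_) (fun s' hF hJ v => hJ v v.2))
    fun s₁ hF₁ hs₁ => ?_
  · simp only [wp_store, Expr.val, State.setR_arr, State.setA_arr, hv]
    intro w hw
    split_ifs with h
    · rfl
    · have : (w : ℕ) ≠ v := fun h' => h ⟨trivial, h'⟩
      exact hJ w (show (w : ℕ) < v by omega)
  have hE₁ := hE.frame hF₁
  have hg : s₁.reg R_guess = s.reg R_guess := hF₁.reg _ (by decide)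
  simp only [wp_block_assign, Expr.val]
  refine wp.block (R := fun s' => ∀ v : Fin I.n,
      s'.arr A_mask v ≠ 0 ↔ ∃ j < I.reqBar, s.reg R_guess / I.n ^ j % I.n = v)
    (wp_forLt (N := I.reqBar) (fun j s' => s'.reg R_x = s.reg R_guess / I.n ^ j ∧
        ∀ v : Fin I.n, s'.arr A_mask v ≠ 0 ↔ ∃ i < j, s.reg R_guess / I.n ^ i % I.n = v)
      (by simp [hE₁.req]) hreq (by decide) (by decide) (by decide) (by simp [hg, hs₁])
      (fun j s' hj hij hF hJ => ?_) (fun s' hF hJ => hJ.2))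
    fun s₂ hF₂ hs₂ => ?_
  · have hn' : s'.reg R_n = I.n := by rw [hF.reg _ (by decide)]; simp [hE₁.n]
    have hx' : s'.reg R_x ≤ M := by rw [hJ.1]; exact (Nat.div_le_self _ _).trans hM
    refine wp.block (divModProg_spec I.n_pos hn' hx') fun s'' hF' hs'' => ?_
    have ha : s''.arr A_mask = s'.arr A_mask := hF'.arr _ (by decide)
    simp only [wp_block_assign, wp_block_store, wp_block_nil, Expr.val]
    refine ⟨?_, fun v => ?_⟩
    · simp [hs''.2, hJ.1, Nat.div_div_eq_div_mul, pow_succ]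
    · simp only [State.setR_arr, State.setA_arr, hs''.1, hJ.1, true_and, ha]
      by_cases h : (v : ℕ) = s.reg R_guess / I.n ^ j % I.n
      · simp only [h, if_true]
        simpa using ⟨j, le_rfl, rfl⟩
      · simp only [h, if_false]
        rw [hJ.2]
        constructor
        · rintro ⟨i, hi, hiv⟩
          exact ⟨i, by omega, hiv⟩
        · rintro ⟨i, hi, hiv⟩
          refine ⟨i, lt_of_le_of_ne (Nat.lt_succ_iff.1 hi) ?_, hiv⟩
          rintro rfl
          exact h hiv.symm
  have hroot : s₂.reg R_root = I.iStar := by rw [hF₂.reg _ (by decide)]; simp [hE₁.root]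
  simp only [wp_block_store, wp_block_nil, Expr.val]
  intro v
  simp only [State.setA_arr, hroot, true_and, digitSet, Finset.mem_filter, Finset.mem_univ,
    ← Fin.ext_iff]
  by_cases h : v = I.iStar
  · simp [h]
  · simp [h, hs₂]

/-! ### Costs and free arcs -/

theorem forall_lt_succ {n : ℕ} {P : Fin n → Prop} {v : Fin n} (h : ∀ w : Fin n, (w : ℕ) < v → P w)
    (hv : P v) (w : Fin n) (hw : (w : ℕ) < v + 1) : P w := by
  rcases Nat.lt_succ_iff_lt_or_eq.1 hw with h' | h'
  · exact h w h'
  · exact Fin.ext h' ▸ hv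

theorem exists_lt_succ {n : ℕ} {P : Fin n → Prop} {v : Fin n} :
    (∃ w : Fin n, (w : ℕ) < v + 1 ∧ P w) ↔ (∃ w : Fin n, (w : ℕ) < v ∧ P w) ∨ P v := by
  constructor
  · rintro ⟨w, hw, h⟩
    rcases Nat.lt_succ_iff_lt_or_eq.1 hw with h' | h'
    · exact .inl ⟨w, h', h⟩
    · exact .inr (Fin.ext h' ▸ h)
  · rintro (⟨w, hw, h⟩ | h)
    · exact ⟨w, by omega, h⟩
    · exact ⟨v, by omega, h⟩

theorem Env.setR (h : Env I s) {r v : ℕ} (hr : r = 4 ∨ 5 < r := by decide) : Env I (s.setR r v) :=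
  h.frame (p := .assign r (.const 0))
    ⟨fun r' h' => by simp_all [Prog.regs], fun _ _ => rfl⟩ (by simpa [Prog.regs] using hr)
    (by simp [Prog.arrs])

theorem Env.val_cellExpr (hE : Env I s) {i j : ℕ} {u v : Fin I.n} (hu : s.reg i = u)
    (hv : s.reg j = v) : (cellExpr i j).val s = cell u v := by
  simp [cellExpr, Expr.val, hu, hv, hE.row, cell]

theorem Env.val_delegExpr (hE : Env I s) {i : ℕ} {u : Fin I.n} (hu : s.reg i = u) :
    (delegExpr i).val s = I.d u := by
  simp [delegExpr, Expr.val, hu, hE.n, hE.deleg]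

theorem Env.val_weightExpr (hE : Env I s) {i : ℕ} {u : Fin I.n} (hu : s.reg i = u) :
    (weightExpr i).val s = I.ω u := by
  simp [weightExpr, Expr.val, hu, hE.weight]

theorem Env.val_adjExpr (hE : Env I s) {i j : ℕ} {u v : Fin I.n} (hu : s.reg i = u)
    (hv : s.reg j = v) : (adjExpr i j).val s ≠ 0 ↔ (u, v) ∈ I.A := by
  simp [adjExpr, Expr.val, hE.val_cellExpr hu hv, hE.n, hE.adj]

theorem IsMask.congr {S : Finset (Fin I.n)} (h : IsMask I S s) (ha : s'.arr A_mask = s.arr A_mask) :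
    IsMask I S s' := by
  intro v
  rw [ha]
  exact h v

/-- Store the free arcs, and compute the number of forced changes and the weight inside the
subtree. -/
def freeProg : Prog := .block [
  .assign R_cost (.const 0),
  .assign R_weight (.const 0),
  .forLt R_i R_n (.block [
    .assign R_deleg (delegExpr R_i),
    .ite (.arr A_mask (.reg R_i))
      (.block [
        .store A_free (.reg R_i) (.reg R_root),
        .ite (.arr A_mask (.reg R_deleg))
          .skip
          (.assign R_cost (.add (.reg R_cost) (.const 1)))])
      (.block [
        .assign R_weight (.add (.reg R_weight) (weightExpr R_i)),
        .ite (Expr.neTest (.reg R_i) (.reg R_root))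
          (.ite (.arr A_mask (.reg R_deleg))
            (.store A_free (.reg R_i) (.reg R_i))
            (.store A_free (.reg R_i) (.reg R_deleg)))
          (.block [
            .store A_free (.reg R_i) (.reg R_root),
            .ite (Expr.neTest (.reg R_deleg) (.reg R_root))
              (.assign R_cost (.add (.reg R_cost) (.const 1)))
              .skip])])])]

/-- The array `A_free` contains the values of `f`. -/
def IsFree (I : WMaxPInstance) (f : Fin I.n → Fin I.n) (s : State) : Prop :=
  ∀ v : Fin I.n, s.arr A_free v = f v

theorem freeProg_spec (hE : Env I s) (hn : I.n ≤ M) {S : Finset (Fin I.n)} (hS : IsMask I S s)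
    (hρ : I.iStar ∉ S) :
    wp M freeProg s fun s' => IsFree I (I.freeArc S) s' ∧ s'.reg R_cost = (I.forced S).card ∧
      s'.reg R_weight = ∑ v ∈ Sᶜ, (I.ω v : ℕ) := by
  classical
  set g : Fin I.n → ℕ := fun v => if v ∈ S ∧ I.d v ∉ S ∨ v = I.iStar ∧ I.d v ≠ v then 1 else 0
    with hg
  set h : Fin I.n → ℕ := fun v => if v ∈ Sᶜ then (I.ω v : ℕ) else 0 with hh
  unfold freeProg
  simp only [wp_block_assign, Expr.val]
  refine wp.block (R := _) (wp_forFin (n := I.n) (fun j s' =>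
    (∀ v : Fin I.n, (v : ℕ) < j → s'.arr A_free v = I.freeArc S v) ∧
      s'.reg R_cost = partialSum g j ∧ s'.reg R_weight = partialSum h j)
    (by simp [hE.n]) hn (by simp) (fun v s' hv hF hJ => ?_)
    (fun s' hF hJ => ⟨fun v => hJ.1 v v.2, ?_⟩))
    fun s' _ hs' => hs'
  · have hE' : Env I s' := (Env.setR (Env.setR hE)).frame hF
    have hmask : s'.arr A_mask = s.arr A_mask := hF.arr _ (by decide)
    have hm : ∀ v : Fin I.n, s'.arr A_mask v ≠ 0 ↔ v ∈ S := hS.congr hmask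
    obtain ⟨h₁, h₂, h₃⟩ := hJ
    have hd := hE'.val_delegExpr hv
    simp only [wp_block_assign, hd]
    refine wp.block (R := fun s'' => ((∀ w : Fin I.n, (w : ℕ) < v + 1 →
        s''.arr A_free w = I.freeArc S w) ∧
      s''.reg R_cost = partialSum g (v + 1) ∧ s''.reg R_weight = partialSum h (v + 1)))
      ((wp_ite (P := v ∈ S) (by simpa [Expr.val, hv] using hm v)).2
        ⟨fun hvS => ?_, fun hvS => ?_⟩) fun s'' _ hs'' => ?_
    · have hfree : I.freeArc S v = I.iStar := by simp [freeArc, hvS]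
      have hvρ : v ≠ I.iStar := fun h' => hρ (h' ▸ hvS)
      simp only [wp_block_store, Expr.val]
      refine wp.block ((wp_ite (P := I.d v ∈ S) (by simpa [Expr.val] using hm (I.d v))).2
        ⟨fun hdS => ?_, fun hdS => ?_⟩) fun s'' _ hs'' => hs''
      · refine ⟨forall_lt_succ (fun w hw => ?_) ?_, ?_, ?_⟩
        · simpa [hv, (Nat.ne_of_lt hw)] using h₁ w hw
        · simp [hv, hE'.root, hfree]
        · simp [h₂, partialSum_succ, hg, hvS, hdS, hvρ]
        · simp [h₃, partialSum_succ, hh, hvS]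
      · refine ⟨forall_lt_succ (fun w hw => ?_) ?_, ?_, ?_⟩
        · simpa [hv, (Nat.ne_of_lt hw)] using h₁ w hw
        · simp [hv, hE'.root, hfree]
        · simp [Expr.val, h₂, partialSum_succ, hg, hvS, hdS]
        · simp [h₃, partialSum_succ, hh, hvS]
    · have hw : (weightExpr R_i).val (s'.setR R_deleg (I.d v)) = I.ω v :=
        (Env.setR hE').val_weightExpr (by simpa using hv)
      simp only [wp_block_assign, Expr.val, hw]
      refine wp.block ((wp_ite (P := v ≠ I.iStar) (by
        rw [Expr.val_neTest]; simp [Expr.val, hv, hE'.root, Fin.ext_iff])).2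
        ⟨fun hvρ => ?_, fun hvρ => ?_⟩) fun s'' _ hs'' => hs''
      · refine (wp_ite (P := I.d v ∈ S) (by simpa [Expr.val] using hm (I.d v))).2
          ⟨fun hdS => ?_, fun hdS => ?_⟩
        · refine ⟨forall_lt_succ (fun w hw => ?_) ?_, ?_, ?_⟩
          · simpa [Expr.val, hv, (Nat.ne_of_lt hw)] using h₁ w hw
          · simp [Expr.val, hv, freeArc, hvS, hvρ, hdS]
          · simp [h₂, partialSum_succ, hg, hvS, hvρ]
          · simp [h₃, partialSum_succ, hh, hvS]
        · refine ⟨forall_lt_succ (fun w hw => ?_) ?_, ?_, ?_⟩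
          · simpa [Expr.val, hv, (Nat.ne_of_lt hw)] using h₁ w hw
          · simp [Expr.val, hv, freeArc, hvS, hvρ, hdS]
          · simp [h₂, partialSum_succ, hg, hvS, hvρ]
          · simp [h₃, partialSum_succ, hh, hvS]
      · rw [not_not] at hvρ
        have hfree : I.freeArc S v = I.iStar := by simp [freeArc, hvρ]
        simp only [wp_block_store, Expr.val]
        refine wp.block ((wp_ite (P := I.d v ≠ v) (by
          rw [Expr.val_neTest]; simp [Expr.val, hE'.root, Fin.ext_iff, hvρ])).2
          ⟨fun hdv => ?_, fun hdv => ?_⟩) fun s'' _ hs'' => hs''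
        · refine ⟨forall_lt_succ (fun w hw => ?_) ?_, ?_, ?_⟩
          · simpa [hv, (Nat.ne_of_lt hw)] using h₁ w hw
          · simp [hv, hE'.root, hfree]
          · simp [Expr.val, h₂, partialSum_succ, hg, hvρ ▸ hdv, hvρ]
          · simp [h₃, partialSum_succ, hh, hvS]
        · rw [not_not] at hdv
          refine ⟨forall_lt_succ (fun w hw => ?_) ?_, ?_, ?_⟩
          · simpa [hv, (Nat.ne_of_lt hw)] using h₁ w hw
          · simp [hv, hE'.root, hfree]
          · simp [h₂, partialSum_succ, hg, hvS, hdv]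
          · simp [h₃, partialSum_succ, hh, hvS]
    · simpa using hs''
  · rw [hJ.2.1, hJ.2.2, partialSum_self, partialSum_self, hg, hh, forced, Finset.card_filter,
      Finset.sum_ite_mem, Finset.univ_inter]
    exact ⟨rfl, rfl⟩

/-! ### The reachability matrix of the free arcs -/

/-- The matrix in the array `A_reach` represents the relation `C`. -/
def IsReach (I : WMaxPInstance) (C : Fin I.n → Fin I.n → Prop) (s : State) : Prop :=
  ∀ u v, s.arr A_reach (cell u v) ≠ 0 ↔ C u v

theorem IsReach.congr {C : Fin I.n → Fin I.n → Prop} (h : IsReach I C s)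
    (ha : s'.arr A_reach = s.arr A_reach) : IsReach I C s' := by
  intro u v
  rw [ha]
  exact h u v

theorem IsReach.val {C : Fin I.n → Fin I.n → Prop} (h : IsReach I C s) (hE : Env I s) {i j : ℕ}
    {u v : Fin I.n} (hu : s.reg i = u) (hv : s.reg j = v) :
    (reachExpr i j).val s ≠ 0 ↔ C u v := by
  rw [reachExpr, Expr.val, hE.val_cellExpr hu hv]
  exact h u v

/-- Compute the reachability matrix of the free arcs by following them from every vertex; `n` visits
suffice by `exists_iterate_lt_card`. -/
def reachProg : Prog := .block [
  .forLt R_i R_n (.forLt R_j R_n (.store A_reach (cellExpr R_i R_j) (.const 0))),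
  .forLt R_i R_n (.block [
    .assign R_x (.reg R_i),
    .forLt R_j R_n (.block [
      .store A_reach (cellExpr R_i R_x) (.const 1),
      .assign R_x (.arr A_free (.reg R_x))])])]

theorem reachProg_spec (hE : Env I s) (hn : I.n ≤ M) {f : Fin I.n → Fin I.n}
    (hf : IsFree I f s) :
    wp M reachProg s (IsReach I fun u v => ∃ m, f^[m] u = v) := by
  unfold reachProg
  refine wp.block (R := fun s' => ∀ u v : Fin I.n, s'.arr A_reach (cell u v) = 0)
    (wp_forFin (n := I.n)
      (fun j s' => ∀ u v : Fin I.n, (u : ℕ) < j → s'.arr A_reach (cell u v) = 0)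
      hE.n hn (by simp) (fun u s' hu hF hJ => ?_) (fun s' _ hJ u v => hJ u v u.2))
    fun s₁ hF₁ hs₁ => ?_
  · have hE' := hE.frame hF
    refine wp_forFin (n := I.n)
      (fun k s'' => ∀ u' v' : Fin I.n, (u' : ℕ) < u ∨ u' = u ∧ (v' : ℕ) < k →
        s''.arr A_reach (cell u' v') = 0) hE'.n hn (by simpa using hJ)
      (fun v s'' hv hF' hJ' => ?_) (fun s'' _ hJ' u' v' hu' => ?_)
    · have hE'' := hE'.frame hF'
      have hu'' : s''.reg R_i = u := (hF'.reg _ (by decide)).trans hu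
      simp only [wp_store, State.setR_arr, State.setA_arr, hE''.val_cellExpr hu'' hv, cell_inj,
        true_and, Expr.val]
      intro u' v' h
      split_ifs with h'
      · rfl
      · refine hJ' u' v' (h.imp_right fun h => ⟨h.1, ?_⟩)
        have : (v' : ℕ) ≠ v := fun h'' => h' ⟨h.1, Fin.ext h''⟩
        omega
    · refine hJ' u' v' ?_
      rcases Nat.lt_succ_iff_lt_or_eq.1 hu' with h | h
      · exact .inl h
      · exact .inr ⟨Fin.ext h, v'.2⟩
  have hE₁ := hE.frame hF₁
  have hf₁ : ∀ v : Fin I.n, s₁.arr A_free v = f v := fun v => by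
    rw [hF₁.arr _ (by decide)]; exact hf v
  refine wp.block (wp_forFin (n := I.n)
      (fun j s' => ∀ u v : Fin I.n, s'.arr A_reach (cell u v) ≠ 0 ↔
        (u : ℕ) < j ∧ ∃ m, f^[m] u = v)
      hE₁.n hn (by simpa using hs₁) (fun u s' hu hF hJ => ?_)
      (fun s' _ hJ u v => (hJ u v).trans (and_iff_right u.2)))
    fun s' _ hs' => hs'
  have hE' := hE₁.frame hF
  simp only [wp_block_assign, Expr.val, hu]
  refine wp.block (wp_forFin (n := I.n)
    (fun k s'' => s''.reg R_x = f^[k] u ∧ ∀ u' v' : Fin I.n, s''.arr A_reach (cell u' v') ≠ 0 ↔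
        ((u' : ℕ) < u ∧ ∃ m, f^[m] u' = v') ∨ u' = u ∧ ∃ m < k, f^[m] u = v')
    (by simpa using hE'.n) hn ⟨by simp, by simpa using hJ⟩
    (fun k s'' hk hF' hJ' => ?_) (fun s'' _ hJ' => ?_)) fun s'' _ hs'' => hs''
  · have hE'' : Env I s'' := (Env.setR hE').frame hF'
    have hu'' : s''.reg R_i = u := by rw [hF'.reg _ (by decide)]; simpa using hu
    have hf'' : ∀ v : Fin I.n, s''.arr A_free v = f v := fun v => by
      rw [hF'.arr _ (by decide), State.setR_arr, hF.arr _ (by decide)]; exact hf₁ v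
    simp only [wp_block_assign, wp_block_store, wp_block_nil, Expr.val,
      hE''.val_cellExpr hu'' hJ'.1]
    refine ⟨?_, fun u' v' => ?_⟩
    · simp [hJ'.1, hf'', Function.iterate_succ_apply']
    · simp only [State.setR_arr, State.setA_arr, cell_inj, true_and, Nat.lt_succ_iff_lt_or_eq,
        or_and_right, exists_or, exists_eq_left]
      by_cases h : u' = u ∧ v' = f^[k] u
      · simp [h.1, h.2]
      · rw [if_neg h, hJ'.2]
        have h' : u' = u → f^[k] u ≠ v' := fun h₁ h₂ => h ⟨h₁, h₂.symm⟩
        exact or_congr_right (and_congr_right fun h₁ => (or_iff_left (h' h₁)).symm)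
  · intro u' v'
    simp only [State.setR_arr]
    rw [hJ'.2, Nat.lt_succ_iff_lt_or_eq, or_and_right]
    refine or_congr_right ⟨?_, ?_⟩
    · rintro ⟨rfl, m, -, hm⟩
      exact ⟨rfl, m, hm⟩
    · rintro ⟨h, hm⟩
      obtain rfl := Fin.ext h
      obtain ⟨m, hm, h'⟩ := exists_iterate_lt_card hm
      exact ⟨rfl, m, by simpa using hm, h'⟩

/-! ### The rounds of the arborescence algorithm -/

/-- Look for a sink component that does not contain the root; `R_found` tells whether there is one,
and a vertex of it is put into `R_sink`. -/
def findProg : Prog := .block [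
  .assign R_found (.const 0),
  .forLt R_i R_n (.block [
    .ite (reachExpr R_i R_root) (.assign R_ok (.const 0)) (.assign R_ok (.const 1)),
    .forLt R_j R_n (.ite (reachExpr R_i R_j)
      (.ite (reachExpr R_j R_i) .skip (.assign R_ok (.const 0)))
      .skip),
    .ite (.reg R_ok)
      (.block [.assign R_found (.const 1), .assign R_sink (.reg R_i)])
      .skip])]

theorem findProg_spec (hE : Env I s) (hn : I.n ≤ M) {C : Fin I.n → Fin I.n → Prop}
    (hC : IsReach I C s) :
    wp M findProg s fun s' =>
      (s'.reg R_found ≠ 0 → ∃ x : Fin I.n, s'.reg R_sink = x ∧ IsSink C I.iStar x) ∧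
      (s'.reg R_found = 0 → ∀ x, ¬ IsSink C I.iStar x) := by
  unfold findProg
  simp only [wp_block_assign, Expr.val]
  refine wp.block (wp_forFin (n := I.n) (fun j s' =>
      (s'.reg R_found ≠ 0 → ∃ x : Fin I.n, s'.reg R_sink = x ∧ IsSink C I.iStar x) ∧
      (s'.reg R_found = 0 → ∀ x : Fin I.n, (x : ℕ) < j → ¬ IsSink C I.iStar x))
    (by simpa using hE.n) hn (by simp) (fun v s' hv hF hJ => ?_)
    (fun s' _ hJ => ⟨hJ.1, fun h x => hJ.2 h x x.2⟩)) fun s' _ hs' => hs'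
  have hE' : Env I s' := (Env.setR hE).frame hF
  have hC' : IsReach I C s' := hC.congr (hF.arr _ (by decide))
  refine wp.block (R := fun s'' => s''.reg R_ok ≠ 0 ↔ ¬ C v I.iStar)
    ((wp_ite (hC'.val hE' hv hE'.root)).2 ⟨fun h => ?_, fun h => ?_⟩) fun s₁ hF₁ hs₁ => ?_
  · simp [Expr.val, h]
  · simp [Expr.val, h]
  have hE₁ := hE'.frame hF₁
  have hC₁ : IsReach I C s₁ := hC'.congr (hF₁.arr _ (by decide))
  have hv₁ : s₁.reg R_i = v := (hF₁.reg _ (by decide)).trans hv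
  refine wp.block (R := fun s'' => s''.reg R_ok ≠ 0 ↔ IsSink C I.iStar v)
    (wp_forFin (n := I.n) (fun k s'' => s''.reg R_ok ≠ 0 ↔
        ¬ C v I.iStar ∧ ∀ j : Fin I.n, (j : ℕ) < k → C v j → C j v)
      hE₁.n hn (by simpa using hs₁) (fun k s'' hk hF' hJ' => ?_)
      (fun s'' _ hJ' => hJ'.trans (and_congr_right fun _ =>
        ⟨fun h j => h j j.2, fun h j _ => h j⟩)))
    fun s₂ hF₂ hs₂ => ?_
  · have hE'' := hE₁.frame hF'
    have hC'' : IsReach I C s'' := hC₁.congr (hF'.arr _ (by decide))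
    have hv'' : s''.reg R_i = v := (hF'.reg _ (by decide)).trans hv₁
    have keep : (C v k → C k v) → ((s''.setR R_j (k + 1)).reg R_ok ≠ 0 ↔
        ¬ C v I.iStar ∧ ∀ j : Fin I.n, (j : ℕ) < k + 1 → C v j → C j v) := by
      intro h
      rw [State.setR_reg, if_neg (by decide), hJ']
      exact and_congr_right fun _ =>
        ⟨fun h' => forall_lt_succ h' h, fun h' j hj => h' j (by omega)⟩
    refine (wp_ite (hC''.val hE'' hv'' hk)).2 ⟨fun h => ?_, fun h => keep fun h' => absurd h' h⟩
    refine (wp_ite (hC''.val hE'' hk hv'')).2 ⟨fun h' => keep fun _ => h', fun h' => ?_⟩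
    simp only [wp_assign, Expr.val, State.setR_reg]
    simp only [Nat.reduceEqDiff, if_true, if_false, ne_eq, not_true, false_iff]
    exact fun hs => h' (hs.2 k (Nat.lt_succ_self _) h)
  have hJ₂ : s₂.reg R_found = s'.reg R_found ∧ s₂.reg R_sink = s'.reg R_sink :=
    ⟨(hF₂.reg _ (by decide)).trans (hF₁.reg _ (by decide)),
      (hF₂.reg _ (by decide)).trans (hF₁.reg _ (by decide))⟩
  have hv₂ : s₂.reg R_i = v := (hF₂.reg _ (by decide)).trans hv₁
  refine wp.block ((wp_ite (e := .reg R_ok) hs₂).2 ⟨fun h => ?_, fun h => ?_⟩) fun s'' _ hs'' => hs''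
  · simp only [wp_block_assign, wp_block_nil, Expr.val]
    exact ⟨fun _ => ⟨v, by simpa using hv₂, h⟩, fun h' => by simp at h'⟩
  · rw [← hJ₂.1, ← hJ₂.2] at hJ
    simp only [wp_skip, State.setR_reg, Nat.reduceEqDiff, if_false]
    exact ⟨hJ.1, fun h' => forall_lt_succ (hJ.2 h') h⟩

/-- Mark in the array `A_target` everything reached from the head of an allowed arc that leaves
`R_i`. -/
def targetProg : Prog :=
  .forLt R_w R_n (.ite (adjExpr R_i R_w)
    (.ite (.arr A_mask (.reg R_w))
      .skip
      (.forLt R_j R_n (.ite (reachExpr R_w R_j)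
        (.store A_target (.reg R_j) (.const 1))
        .skip)))
    .skip)

theorem targetProg_spec (hE : Env I s) (hn : I.n ≤ M) {S : Finset (Fin I.n)} (hS : IsMask I S s)
    {C : Fin I.n → Fin I.n → Prop} (hC : IsReach I C s) {u : Fin I.n} (hu : s.reg R_i = u) :
    wp M targetProg s fun s' => ∀ v : Fin I.n, s'.arr A_target v ≠ 0 ↔
      s.arr A_target v ≠ 0 ∨ ∃ w, I.AllowedArc S u w ∧ C w v := by
  unfold targetProg
  refine wp_forFin (n := I.n) (fun k s' => ∀ v : Fin I.n, s'.arr A_target v ≠ 0 ↔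
      s.arr A_target v ≠ 0 ∨ ∃ w : Fin I.n, (w : ℕ) < k ∧ I.AllowedArc S u w ∧ C w v)
    hE.n hn (by simp) (fun w s' hw hF hJ => ?_)
    (fun s' _ hJ v => (hJ v).trans (by simp))
  have hE' := hE.frame hF
  have hC' : IsReach I C s' := hC.congr (hF.arr _ (by decide))
  have hS' : IsMask I S s' := hS.congr (hF.arr _ (by decide))
  have hu' : s'.reg R_i = u := (hF.reg _ (by decide)).trans hu
  have keep : ¬ I.AllowedArc S u w → ∀ v : Fin I.n, s'.arr A_target v ≠ 0 ↔
      s.arr A_target v ≠ 0 ∨ ∃ w' : Fin I.n, (w' : ℕ) < w + 1 ∧ I.AllowedArc S u w' ∧ C w' v := by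
    intro h v
    rw [hJ, exists_lt_succ, or_iff_left (b := I.AllowedArc S u w ∧ _) fun h' => h h'.1]
  refine (wp_ite (hE'.val_adjExpr hu' hw)).2 ⟨fun hA => ?_, fun h => keep fun h' => h h'.1⟩
  refine (wp_ite (P := w ∈ S) (by simpa [Expr.val, hw] using hS' w)).2
    ⟨fun h => keep fun h' => h'.2 h, fun hwS => ?_⟩
  refine wp_forFin (n := I.n) (fun j s'' => ∀ v : Fin I.n, s''.arr A_target v ≠ 0 ↔
      s'.arr A_target v ≠ 0 ∨ (v : ℕ) < j ∧ C w v)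
    hE'.n hn (by simp) (fun j s'' hj hF' hJ' => ?_) (fun s'' _ hJ' v => ?_)
  · have hE'' := hE'.frame hF'
    have hC'' : IsReach I C s'' := hC'.congr (hF'.arr _ (by decide))
    have hw'' : s''.reg R_w = w := (hF'.reg _ (by decide)).trans hw
    refine (wp_ite (hC''.val hE'' hw'' hj)).2 ⟨fun h v => ?_, fun h v => ?_⟩
    · simp only [Expr.val, State.setR_arr, State.setA_arr, hj, true_and, ← Fin.ext_iff]
      by_cases hvj : v = j
      · subst hvj
        simp [h]
      · rw [if_neg hvj, hJ', Nat.lt_succ_iff_lt_or_eq, ← Fin.ext_iff, or_iff_left hvj]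
    · rw [State.setR_arr, hJ', Nat.lt_succ_iff_lt_or_eq, ← Fin.ext_iff, or_and_right,
        or_iff_left (b := v = j ∧ C w v)]
      rintro ⟨rfl, h'⟩
      exact h h'
  · rw [State.setR_arr, hJ', hJ, exists_lt_succ, and_iff_right v.2, or_assoc,
      and_iff_right (show I.AllowedArc S u w from ⟨hA, hwS⟩)]

/-- Make the arcs that leave the component of `R_sink` free. -/
def extendProg : Prog := .block [
  .forLt R_j R_n (.store A_target (.reg R_j) (.const 0)),
  .forLt R_i R_n (.ite (reachExpr R_sink R_i) targetProg .skip),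
  .forLt R_i R_n (.ite (reachExpr R_i R_sink)
    (.forLt R_j R_n (.ite (.arr A_target (.reg R_j))
      (.store A_reach (cellExpr R_i R_j) (.const 1))
      .skip))
    .skip)]

theorem extendProg_spec (hE : Env I s) (hn : I.n ≤ M) {S : Finset (Fin I.n)} (hS : IsMask I S s)
    {C : Fin I.n → Fin I.n → Prop} (hC : IsReach I C s) {x : Fin I.n} (hx : s.reg R_sink = x) :
    wp M extendProg s (IsReach I (extend (I.AllowedArc S) C x)) := by
  unfold extendProg
  refine wp.block (R := fun s' => ∀ v : Fin I.n, s'.arr A_target v = 0)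
    (wp_forFin (n := I.n) (fun j s' => ∀ v : Fin I.n, (v : ℕ) < j → s'.arr A_target v = 0)
      hE.n hn (by simp) (fun v s' hv hF hJ => ?_) (fun s' _ hJ v => hJ v v.2))
    fun s₁ hF₁ hs₁ => ?_
  · refine forall_lt_succ (fun w hw => ?_) ?_
    · simpa [Expr.val, hv, Nat.ne_of_lt hw] using hJ w hw
    · simp [Expr.val, hv]
  have hE₁ := hE.frame hF₁
  have hS₁ : IsMask I S s₁ := hS.congr (hF₁.arr _ (by decide))
  have hC₁ : IsReach I C s₁ := hC.congr (hF₁.arr _ (by decide))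
  have hx₁ : s₁.reg R_sink = x := (hF₁.reg _ (by decide)).trans hx
  refine wp.block (R := fun s' => ∀ v : Fin I.n, s'.arr A_target v ≠ 0 ↔
      ∃ u w, C x u ∧ I.AllowedArc S u w ∧ C w v)
    (wp_forFin (n := I.n) (fun j s' => ∀ v : Fin I.n, s'.arr A_target v ≠ 0 ↔
        ∃ u : Fin I.n, (u : ℕ) < j ∧ ∃ w, C x u ∧ I.AllowedArc S u w ∧ C w v)
      hE₁.n hn (by simpa using hs₁) (fun u s' hu hF hJ => ?_)
      (fun s' _ hJ v => (hJ v).trans (by simp)))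
    fun s₂ hF₂ hs₂ => ?_
  · have hE' := hE₁.frame hF
    have hS' : IsMask I S s' := hS₁.congr (hF.arr _ (by decide))
    have hC' : IsReach I C s' := hC₁.congr (hF.arr _ (by decide))
    have hx' : s'.reg R_sink = x := (hF.reg _ (by decide)).trans hx₁
    refine (wp_ite (hC'.val hE' hx' hu)).2 ⟨fun h => ?_, fun h v => ?_⟩
    · refine (targetProg_spec hE' hn hS' hC' hu).mono fun s'' hs'' v => ?_
      rw [State.setR_arr, hs'', hJ, exists_lt_succ]
      simp only [h, true_and]
    · rw [State.setR_arr, hJ, exists_lt_succ, or_iff_left]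
      rintro ⟨w, h', -⟩
      exact h h'
  have hE₂ := hE₁.frame hF₂
  have hC₂ : IsReach I C s₂ := hC₁.congr (hF₂.arr _ (by decide))
  have hx₂ : s₂.reg R_sink = x := (hF₂.reg _ (by decide)).trans hx₁
  refine wp.block (wp_forFin (n := I.n) (fun j s' => ∀ u v : Fin I.n,
      s'.arr A_reach (cell u v) ≠ 0 ↔ C u v ∨ (u : ℕ) < j ∧ C u x ∧ s₂.arr A_target v ≠ 0)
    hE₂.n hn (by simpa [IsReach] using hC₂) (fun u s' hu hF hJ => ?_) (fun s' _ hJ u v => ?_))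
    fun s' _ hs' => hs'
  · have hE' := hE₂.frame hF
    have hx' : s'.reg R_sink = x := (hF.reg _ (by decide)).trans hx₂
    have ht' : s'.arr A_target = s₂.arr A_target := hF.arr _ (by decide)
    -- the entry `(u, x)` of the matrix is not changed before row `u` is updated
    have hux : (reachExpr R_i R_sink).val s' ≠ 0 ↔ C u x := by
      rw [reachExpr, Expr.val, hE'.val_cellExpr hu hx', hJ]
      simp
    refine (wp_ite hux).2 ⟨fun h => ?_, fun h u' v => ?_⟩
    · refine wp_forFin (n := I.n) (fun k s'' => ∀ u' v : Fin I.n,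
          s''.arr A_reach (cell u' v) ≠ 0 ↔ s'.arr A_reach (cell u' v) ≠ 0 ∨
            u' = u ∧ (v : ℕ) < k ∧ s₂.arr A_target v ≠ 0)
        hE'.n hn (by simp) (fun v s'' hv hF' hJ' => ?_) (fun s'' _ hJ' u' v => ?_)
      · have hE'' := hE'.frame hF'
        have hu'' : s''.reg R_i = u := (hF'.reg _ (by decide)).trans hu
        have ht'' : s''.arr A_target = s₂.arr A_target := (hF'.arr _ (by decide)).trans ht'
        refine (wp_ite (P := s₂.arr A_target v ≠ 0) (by simp [Expr.val, hv, ht''])).2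
          ⟨fun h' u' v' => ?_, fun h' u' v' => ?_⟩
        · simp only [Expr.val, State.setR_arr, State.setA_arr, hE''.val_cellExpr hu'' hv, true_and,
            cell_inj]
          by_cases huv : u' = u ∧ v' = v
          · obtain ⟨rfl, rfl⟩ := huv
            simp [h']
          · rw [if_neg huv, hJ', Nat.lt_succ_iff_lt_or_eq, ← Fin.ext_iff]
            exact or_congr_right (and_congr_right fun h₁ => and_congr_left fun _ =>
              (or_iff_left fun h₂ => huv ⟨h₁, h₂⟩).symm)
        · rw [State.setR_arr, hJ', Nat.lt_succ_iff_lt_or_eq, ← Fin.ext_iff]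
          refine or_congr_right (and_congr_right fun _ => ?_)
          rw [or_and_right, or_iff_left (b := v' = v ∧ _)]
          rintro ⟨rfl, h₁⟩
          exact h' h₁
      · rw [State.setR_arr, hJ', hJ, Nat.lt_succ_iff_lt_or_eq, ← Fin.ext_iff, and_iff_right v.2,
          or_and_right, or_assoc]
        refine or_congr_right (or_congr_right (and_congr_right ?_))
        rintro rfl
        rw [and_iff_right h]
    · rw [State.setR_arr, hJ, Nat.lt_succ_iff_lt_or_eq, ← Fin.ext_iff, or_and_right,
        or_iff_left (b := u' = u ∧ _)]
      rintro ⟨rfl, h', -⟩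
      exact h h'
  · rw [hJ, hs₂, and_iff_right u.2]
    rfl

/-- As many rounds as there are voters; a round without a sink component does nothing. -/
def roundsProg : Prog :=
  .forLt R_round R_n (.block [
    findProg,
    .ite (.reg R_found)
      (.block [.assign R_cost (.add (.reg R_cost) (.const 1)), extendProg])
      .skip])

theorem roundsProg_spec (hE : Env I s) (hn : I.n ≤ M) {S : Finset (Fin I.n)} (hS : IsMask I S s)
    {f : Fin I.n → Fin I.n} (hC : IsReach I (fun u v => ∃ m, f^[m] u = v) s) :
    wp M roundsProg s fun s' => ∃ c C, Grow f (I.AllowedArc S) I.iStar c C ∧ IsReach I C s' ∧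
      s'.reg R_cost = s.reg R_cost + c ∧ (c = I.n ∨ ∀ x, ¬ IsSink C I.iStar x) := by
  unfold roundsProg
  refine wp_forFin (n := I.n) (fun j s' => ∃ c C, Grow f (I.AllowedArc S) I.iStar c C ∧
      IsReach I C s' ∧ s'.reg R_cost = s.reg R_cost + c ∧ (c = j ∨ ∀ x, ¬ IsSink C I.iStar x))
    hE.n hn ⟨0, _, .base, hC, by simp, .inl rfl⟩ (fun j s' hj hF hJ => ?_) (fun s' _ hJ => hJ)
  obtain ⟨c, C, hG, hC', hc, hcj⟩ := hJ
  have hE' := hE.frame hF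
  refine wp.block (findProg_spec hE' hn hC') fun s₁ hF₁ hs₁ => ?_
  have hE₁ := hE'.frame hF₁
  have hC₁ : IsReach I C s₁ := hC'.congr (hF₁.arr _ (by decide))
  have hS₁ : IsMask I S s₁ := hS.congr ((hF₁.arr _ (by decide)).trans (hF.arr _ (by decide)))
  have hc₁ : s₁.reg R_cost = s.reg R_cost + c := (hF₁.reg _ (by decide)).trans hc
  refine wp.block ((wp_ite (e := .reg R_found) Iff.rfl).2 ⟨fun h => ?_, fun h => ?_⟩)
    fun s'' _ hs'' => hs''
  · obtain ⟨x, hx, hsink⟩ := hs₁.1 h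
    simp only [wp_block_assign, Expr.val]
    refine wp.block (extendProg_spec (Env.setR hE₁) hn hS₁ hC₁ (x := x) (by simpa using hx))
      fun s₂ hF₂ hs₂ => ⟨c + 1, _, hG.extend hsink, hs₂, ?_, .inl ?_⟩
    · rw [State.setR_reg, if_neg (by decide), hF₂.reg _ (by decide), State.setR_reg,
        if_pos rfl, hc₁, add_assoc]
    · rw [hcj.resolve_right fun h' => h' x hsink]
  · exact ⟨c, C, hG, hC₁, by simpa using hc₁, .inr (hs₁.2 (not_not.1 h))⟩

/-! ### The whole program -/

/-- The answer becomes positive if all vertices reach the root, the cost is within the budget and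
the weight reaches the threshold. -/
def checkProg : Prog := .block [
  .assign R_ok (.const 1),
  .forLt R_i R_n (.ite (reachExpr R_i R_root) .skip (.assign R_ok (.const 0))),
  .ite (.reg R_ok)
    (.ite (.add (.sub (.reg R_cost) (.arr A_input (.const 2)))
        (.sub (.arr A_input (.const 3)) (.reg R_weight)))
      .skip
      (.assign R_ans (.const 1)))
    .skip]

theorem checkProg_spec (hE : Env I s) (hn : I.n ≤ M) {C : Fin I.n → Fin I.n → Prop}
    (hC : IsReach I C s) {P : Prop}
    (hP : P ↔ I.τ ≤ s.reg R_weight ∧ (∀ v, C v I.iStar) ∧ s.reg R_cost ≤ I.k) :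
    wp M checkProg s fun s' => (P → s'.reg R_ans = 1) ∧ (¬ P → s'.reg R_ans = s.reg R_ans) := by
  unfold checkProg
  simp only [wp_block_assign, Expr.val]
  refine wp.block (R := fun s' => s'.reg R_ok ≠ 0 ↔ ∀ v, C v I.iStar)
    (wp_forFin (n := I.n) (fun j s' => s'.reg R_ok ≠ 0 ↔
        ∀ v : Fin I.n, (v : ℕ) < j → C v I.iStar)
      (by simpa using hE.n) hn (by simp) (fun v s' hv hF hJ => ?_)
      (fun s' _ hJ => hJ.trans ⟨fun h v => h v v.2, fun h v _ => h v⟩))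
    fun s₁ hF₁ hs₁ => ?_
  · have hE' : Env I s' := (Env.setR hE).frame hF
    have hC' : IsReach I C s' := hC.congr (hF.arr _ (by decide))
    refine (wp_ite (hC'.val hE' hv hE'.root)).2 ⟨fun h => ?_, fun h => ?_⟩
    · simp only [wp_skip, State.setR_reg, Nat.reduceEqDiff, if_false, hJ]
      exact ⟨fun h' => forall_lt_succ h' h, fun h' w hw => h' w (by omega)⟩
    · simp only [wp_assign, Expr.val, State.setR_reg, Nat.reduceEqDiff, if_false, if_true, ne_eq,
        not_true, false_iff]
      exact fun h' => h (h' v (Nat.lt_succ_self _))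
  have hE₁ : Env I s₁ := (Env.setR hE).frame hF₁
  have hc₁ : s₁.reg R_cost = s.reg R_cost := hF₁.reg _ (by decide)
  have hw₁ : s₁.reg R_weight = s.reg R_weight := hF₁.reg _ (by decide)
  have ha₁ : s₁.reg R_ans = s.reg R_ans := hF₁.reg _ (by decide)
  refine wp.block ((wp_ite (e := .reg R_ok) hs₁).2 ⟨fun h => ?_, fun h => ?_⟩) fun s' _ hs' => hs'
  · refine (wp_ite (P := ¬ P) ?_).2 ⟨fun h' => ⟨fun h'' => absurd h'' h', fun _ => ha₁⟩,
      fun h' => ⟨fun _ => by simp [Expr.val], fun h'' => absurd h'' h'⟩⟩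
    simp only [Expr.val, hE₁.budget, hE₁.threshold, hc₁, hw₁, hP, h]
    simp only [implies_true, true_and]
    omega
  · exact ⟨fun h' => absurd (hP.1 h').2.1 h, fun _ => ha₁⟩

/-- Test one candidate for the set of voters outside the subtree. -/
def candidateProg : Prog := .block [maskProg, freeProg, reachProg, roundsProg, checkProg]

theorem candidateProg_spec (hE : Env I s) (hn : I.n ≤ M) (hreq : I.reqBar ≤ M)
    (hM : s.reg R_guess ≤ M) :
    wp M candidateProg s fun s' =>
      (I.Good (I.digitSet I.reqBar (s.reg R_guess)) → s'.reg R_ans = 1) ∧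
      (¬ I.Good (I.digitSet I.reqBar (s.reg R_guess)) → s'.reg R_ans = s.reg R_ans) := by
  unfold candidateProg
  set S := I.digitSet I.reqBar (s.reg R_guess) with hS
  refine wp.block (maskProg_spec hE hn hreq hM) fun s₁ hF₁ hs₁ => ?_
  have hE₁ := hE.frame hF₁
  refine wp.block (freeProg_spec hE₁ hn hs₁ (by simp [digitSet])) fun s₂ hF₂ hs₂ => ?_
  have hE₂ := hE₁.frame hF₂
  refine wp.block (reachProg_spec hE₂ hn hs₂.1) fun s₃ hF₃ hs₃ => ?_
  have hE₃ := hE₂.frame hF₃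
  have hS₃ : IsMask I S s₃ := hs₁.congr ((hF₃.arr _ (by decide)).trans (hF₂.arr _ (by decide)))
  refine wp.block (roundsProg_spec hE₃ hn hS₃ hs₃) fun s₄ hF₄ hs₄ => ?_
  have hE₄ := hE₃.frame hF₄
  obtain ⟨c, C, hG, hC, hc, hcn⟩ := hs₄
  have hc₄ : s₄.reg R_cost = (I.forced S).card + c := by
    rw [hc, hF₃.reg _ (by decide), hs₂.2.1]
  have hw₄ : s₄.reg R_weight = ∑ v ∈ Sᶜ, (I.ω v : ℕ) := by
    rw [hF₄.reg _ (by decide), hF₃.reg _ (by decide), hs₂.2.2]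
  have ha₄ : s₄.reg R_ans = s.reg R_ans := by
    rw [hF₄.reg _ (by decide), hF₃.reg _ (by decide), hF₂.reg _ (by decide),
      hF₁.reg _ (by decide)]
  have hgood : I.Good S ↔
      I.τ ≤ s₄.reg R_weight ∧ (∀ v, C v I.iStar) ∧ s₄.reg R_cost ≤ I.k := by
    rw [Good, hG.exists_isTree_iff (by simpa using hcn), hw₄, hc₄]
  refine wp.block (checkProg_spec hE₄ hn hC hgood) fun s₅ _ hs₅ => ?_
  rw [ha₄] at hs₅
  exact hs₅

/-- The program for the weight maximization problem: it tests all candidate sets. -/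
def mainProg : Prog := .block [
  setupProg,
  .forLt R_guess R_count candidateProg,
  .assign 0 (.reg R_ans)]

theorem mainProg_spec (I : WMaxPInstance) (hn : I.n ≤ M) (hreq : I.reqBar ≤ M)
    (hcount : I.n ^ I.reqBar ≤ M) :
    wp M mainProg (initState I.encode) fun s => s.reg 0 = 1 ↔ I.IsYes := by
  unfold mainProg
  refine wp.block (setupProg_spec hn hreq) fun s₁ _ hs₁ => ?_
  refine wp.block (wp_forLt (N := I.n ^ I.reqBar) (fun j s => s.reg R_ans = 1 ↔
      I.τ = 0 ∨ ∃ m < j, I.Good (I.digitSet I.reqBar m))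
    hs₁.1.count hcount (by decide) (by decide) (by decide) ?_ (fun j s hj hij hF hJ => ?_)
    (fun s _ hJ => hJ)) fun s _ hs => ?_
  · simp [hs₁.2]
    omega
  · refine (candidateProg_spec (hs₁.1.frame hF) hn hreq (by omega)).mono fun s' hs' => ?_
    rw [hij] at hs'
    rw [State.setR_reg, if_neg (by decide)]
    by_cases h : I.Good (I.digitSet I.reqBar j)
    · exact iff_of_true (hs'.1 h) (.inr ⟨j, Nat.lt_succ_self j, h⟩)
    · rw [hs'.2 h, hJ]
      refine or_congr_right ⟨fun ⟨m, hm, h'⟩ => ⟨m, by omega, h'⟩, fun ⟨m, hm, h'⟩ => ?_⟩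
      refine ⟨m, lt_of_le_of_ne (Nat.lt_succ_iff.1 hm) ?_, h'⟩
      rintro rfl
      exact h h'
  · rw [I.isYes_iff_exists_digitSet, ← hs]
    simp [Expr.val]

/-! ### The running time -/

theorem n_le_inputSize (I : WMaxPInstance) : I.n + 4 ≤ inputSize I.encode := by
  have h : I.encode.length ≤ inputSize I.encode := by
    rw [inputSize, ← List.length_map (fun w => Nat.size w + 1)]
    refine List.length_le_sum_of_one_le _ fun w hw => ?_
    obtain ⟨v, -, rfl⟩ := List.mem_map.1 hw
    omega
  refine le_trans ?_ h
  simp only [encode, List.length_append, List.length_cons, List.length_nil, List.length_map,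
    List.length_finRange]
  omega

/-- The bound on the iterations of a loop, increased by one, in terms of the input size. -/
theorem iterations_le (I : WMaxPInstance) :
    I.n + I.reqBar + I.n ^ I.reqBar + 1 ≤ inputSize I.encode ^ (I.reqBar + 1) := by
  have hN := I.n_le_inputSize
  set N := inputSize I.encode
  set r := I.reqBar
  have h₁ : I.n ^ r ≤ N ^ r := Nat.pow_le_pow_left (by omega) r
  have h₂ : r < N ^ r := Nat.lt_pow_self (by omega)
  have h₃ : I.n * 1 ≤ I.n * N ^ r := Nat.mul_le_mul_left _ (by omega)
  calc I.n + r + I.n ^ r + 1 ≤ (I.n + 4) * N ^ r := by rw [add_mul]; omega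
    _ ≤ N * N ^ r := Nat.mul_le_mul_right _ hN
    _ = N ^ (r + 1) := (pow_succ' _ _).symm

end LiquidDemocracy.WMaxPInstance

theorem mainTheorem7 :
    InXP LiquidDemocracy.WMaxPInstance.encode LiquidDemocracy.WMaxPInstance.IsYes
      LiquidDemocracy.WMaxPInstance.reqBar := by
  obtain ⟨c, e, hc⟩ := LiquidDemocracy.WMaxPInstance.mainProg.exists_timeBound_le
  refine ⟨LiquidDemocracy.WMaxPInstance.mainProg, fun _ => c, fun r => (r + 1) * e,
    Computable.const c, ?_, fun I => ?_⟩
  · exact (Primrec.nat_mul.comp Primrec.succ (Primrec.const e)).to_comp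
  · obtain ⟨t, s, hexec, ht, hs⟩ := (LiquidDemocracy.WMaxPInstance.mainProg_spec
      (M := I.n + I.reqBar + I.n ^ I.reqBar) I (by omega) (by omega) (by omega)).exec
    refine ⟨t, s, hexec, ht.trans ((hc _).trans ?_), hs⟩
    rw [pow_mul]
    exact Nat.mul_le_mul_left _ (Nat.pow_le_pow_left I.iterations_le e)
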